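/- Let $\tau\in(0,1)$, let $q_0,q_1,q_2,q_3\ge 0$ and $M$ be real numbers, and put $\mathbf q:=\max\{3q_1,\,q_1+q_2,\,q_3\}$, $\bar{\mathbf q}_0:=2\lceil q_0\mathbf q/2\rceil$ and $q^*:=2^{(\bar{\mathbf q}_0+4)/2}$. There is a constant $C_0=C_0(\tau,q_0,\dots,q_3,M)>0$ such that the following holds for all positive integers $n,p,d$ with $\tau\le p/n\le 1/\tau$. *Losses.* Let $\ell_1,\dots,\ell_n:\mathbb R\to\mathbb R$, $\bar\rho\in(0,1]$, $L_{\ell_1},\dots,L_{\ell_n}\ge 1$ and $\mathcal M_\ell,D_\ell:(0,\bar\rho)\to[0,\infty)$ with $\mathcal M_\ell\le 1\le D_\ell$ be such that (i) $\sup_x |\ell_i(x)|/(1+|x|^{q_0})\le L_{\ell_i}$ for all $i$; (ii) for every $\rho\in(0,\bar\rho)$ and every $i$ there is given a function $\ell_{i;\rho}\in C^3(\mathbb R)$ with values in $[0,\infty)$ such that $\|\ell_{i;\rho}-\ell_i\|_\infty\le \mathcal M_\ell(\rho)$ and $\sup_x |\ell_{i;\rho}^{(k)}(x)|/(1+|\ell_{i;\rho}(x)|^{q_k})\le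 D_\ell(\rho)$ for $k=1,2,3$. Let $R:\mathbb R^p\to\mathbb R$ be any function. *Designs.* Let $\Sigma\in\mathbb R^{p\times p}$ be positive definite with $\lambda_{\max}(\Sigma)\le M$. Let $X_1,\dots,X_n$ be i.i.d. random vectors in $\mathbb R^p$, and let $W_1,\dots,W_n$ be i.i.d. random vectors in $\mathbb R^p$, with $E[X_i]=E[W_i]=0$, $E[X_iX_i^\top]=E[W_iW_i^\top]=\Sigma/n$, and $(E|\sqrt n X_{i,j}|^{q^*})^{1/q^*}\le M$, $(E|\sqrt n W_{i,j}|^{q^*})^{1/q^*}\le M$ for all $i\in\{1,\dots,n\}$, $j\in\{1,\dots,p\}$. Suppose that $X_i$ and $W_i$ are $d$-block dependent; here a random vector $Z$ in $\mathbb R^p$ is $d$-block dependent if $\{1,\dots,p\}$ is the union of $k\le p$ pairwise disjoint cells $B_1,\dots,B_k$ with $\max_j|B_j|\le d$ such that the subvectors $(Z_l)_{l\in B_1},\dots,(Z_l)_{l\in B_k}$ are mutually independent. (The partitions for $X_i$ and for $W_i$ may differ.) *Conclusion.* For $w\in\mathbb R^p$ and $\mathbf Z=(Z_1,\dots,Z_n)^\top\in\mathbb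 R^{n\times p}$ put $\bar H_{\ell_\rho}(w,\mathbf Z):=\sum_{i=1}^n \ell_{i;\rho}(Z_i^\top w)+nR(w)$, and for a finite set $\mathcal W$ and $\beta>0$ put $F_\beta\big((x_w)_{w\in\mathcal W}\big):=-\beta^{-1}\log\sum_{w\in\mathcal W}e^{-\beta x_w}$. Then, with $\mathbf X=(X_1,\dots,X_n)^\top$ and $\mathbf W=(W_1,\dots,W_n)^\top$, for every $L_n\ge 1$, every finite set $\mathcal W\subset[-L_n,L_n]^p$, every $\rho\in(0,\bar\rho)$, every $\beta>0$ and every $g\in C^3(\mathbb R)$ with $K_g:=1+\max_{0\le k\le 3}\|g^{(k)}\|_\infty<\infty$, $$ \Big|E\big[g\big(n^{-1}F_\beta((\bar H_{\ell_\rho}(w,\mathbf X))_{w\in\mathcal W})\big)\big]-E\big[g\big(n^{-1}F_\beta((\bar H_{\ell_\rho}(w,\mathbf W))_{w\in\mathcal W})\big)\big]\Big| \le C_0\,K_g\,\max\{1,\beta^2\}\,L_n^{\bar{\mathbf q}_0+3}\,D_\ell(\rho)^3\,\Big(\frac1n\sum_{i=1}^n L_{\ell_i}^{\mathbf q}\Big)\,\sigma_n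 , $$ where $$ \sigma_n:=\frac{p\,d^{\,3+\bar{\mathbf q}_0/2}}{n^{5/2}}+\frac{p\,d^{2}}{n^{3/2}}+\frac{p\,d^{\,\bar{\mathbf q}_0+2}}{n^{(\bar{\mathbf q}_0+3)/2}} . $$ -/

import Mathlib

open MeasureTheory ProbabilityTheory
open scoped ENNReal Matrix

noncomputable section

namespace BlockUniversality

/-- The exponent `max {3 q₁, q₁ + q₂, q₃}`. -/
def qMax (q : Fin 4 → ℝ) : ℝ := max (3 * q 1) (max (q 1 + q 2) (q 3))

/-- The even natural number `2 ⌈q₀ qMax / 2⌉`. -/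
def qBar (q : Fin 4 → ℝ) : ℕ := 2 * ⌈q 0 * qMax q / 2⌉₊

/-- The order `2 ^ ((qBar + 4) / 2)` of the moments of the rescaled covariates. -/
def qStar (q : Fin 4 → ℝ) : ℝ := (2 : ℝ) ^ (((qBar q : ℝ) + 4) / 2)

/-- Proportional regime: `τ ≤ p / n ≤ 1 / τ`. -/
def ProportionalRegime (τ : ℝ) (n p : ℕ) : Prop :=
  0 < n ∧ τ ≤ (p : ℝ) / n ∧ (p : ℝ) / n ≤ 1 / τ

/-- The assumption on the loss functions `ℓ i`, their smooth approximations `ℓs i ρ` for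
`ρ ∈ (0, ρbar)`, the growth constants `Lc i`, the derivative bound `D` and the approximation
error `A`. -/
structure LossAssumption (q : Fin 4 → ℝ) {n : ℕ} (ℓ : Fin n → ℝ → ℝ)
    (ℓs : Fin n → ℝ → ℝ → ℝ) (ρbar : ℝ) (Lc : Fin n → ℝ) (D A : ℝ → ℝ) : Prop where
  q_nonneg : ∀ k, 0 ≤ q k
  ρbar_mem : ρbar ∈ Set.Ioc (0 : ℝ) 1
  one_le_Lc : ∀ i, 1 ≤ Lc i
  A_nonneg : ∀ ρ ∈ Set.Ioo 0 ρbar, 0 ≤ A ρ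
  A_le_one : ∀ ρ ∈ Set.Ioo 0 ρbar, A ρ ≤ 1
  one_le_D : ∀ ρ ∈ Set.Ioo 0 ρbar, 1 ≤ D ρ
  growth : ∀ i x, |ℓ i x| / (1 + |x| ^ q 0) ≤ Lc i
  smooth_nonneg : ∀ i, ∀ ρ ∈ Set.Ioo 0 ρbar, ∀ x, 0 ≤ ℓs i ρ x
  smooth_contDiff : ∀ i, ∀ ρ ∈ Set.Ioo 0 ρbar, ContDiff ℝ 3 (ℓs i ρ)
  approx : ∀ i, ∀ ρ ∈ Set.Ioo 0 ρbar, ∀ x, |ℓs i ρ x - ℓ i x| ≤ A ρ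
  self_bounding : ∀ k : Fin 4, k ≠ 0 → ∀ i, ∀ ρ ∈ Set.Ioo 0 ρbar, ∀ x,
    |iteratedDeriv (k : ℕ) (ℓs i ρ) x| / (1 + |ℓs i ρ x| ^ q k) ≤ D ρ

/-- A random vector `Z` in `ℝ^p` is `d`-block dependent: the coordinates can be partitioned into
`k ≤ p` cells of size at most `d` such that the corresponding subvectors are (mutually)
independent. -/
def IsBlockDependent {Ω : Type*} [MeasurableSpace Ω] (P : Measure Ω) {p : ℕ} (d : ℕ)
    (Z : Ω → Fin p → ℝ) : Prop :=
  ∃ (k : ℕ) (B : Fin k → Finset (Fin p)),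
    k ≤ p ∧
    (∀ i j, i ≠ j → Disjoint (B i) (B j)) ∧
    (∀ l : Fin p, ∃ j, l ∈ B j) ∧
    (∀ j, (B j).card ≤ d) ∧
    iIndepFun (fun (j : Fin k) (ω : Ω) (l : B j) => Z ω l) P

/-- The rows `Z 0, …, Z (n - 1)` are i.i.d. centred `d`-block dependent random vectors in `ℝ^p`
with covariance matrix `S / n`, and the coordinates of the rescaled rows `√n Z i` have `L^r`-norm
at most `M`. -/
structure IsDesign {Ω : Type*} [MeasurableSpace Ω] (P : Measure Ω) {n p : ℕ} (d : ℕ)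
    (S : Matrix (Fin p) (Fin p) ℝ) (r M : ℝ) (Z : Fin n → Ω → Fin p → ℝ) : Prop where
  measurable : ∀ i, Measurable (Z i)
  indep : iIndepFun Z P
  identDistrib : ∀ i j, IdentDistrib (Z i) (Z j) P P
  blockDependent : ∀ i, IsBlockDependent P d (Z i)
  mean : ∀ i j, ∫ ω, Z i ω j ∂P = 0
  secondMoment : ∀ i j k, ∫ ω, Z i ω j * Z i ω k ∂P = S j k / n
  moment : ∀ i j,
    eLpNorm (fun ω => Real.sqrt n * Z i ω j) (ENNReal.ofReal r) P ≤ ENNReal.ofReal M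

/-- The empirical risk `n⁻¹ ∑ᵢ ℓᵢ(Xᵢᵀ w) + R(w)`, where `X i` is the `i`-th row of the design
matrix. -/
def risk {n p : ℕ} (ℓ : Fin n → ℝ → ℝ) (R : (Fin p → ℝ) → ℝ) (w : Fin p → ℝ)
    (X : Fin n → Fin p → ℝ) : ℝ :=
  (1 / (n : ℝ)) * ∑ i, ℓ i (X i ⬝ᵥ w) + R w

/-- The soft minimum `-β⁻¹ log ∑_{w ∈ s} exp (-β x_w)`. -/
def softMin {ι : Type*} (β : ℝ) (s : Finset ι) (x : ι → ℝ) : ℝ :=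
  -(1 / β) * Real.log (∑ w ∈ s, Real.exp (-β * x w))

/-- `n⁻¹ F_β((n H(w, X))_{w ∈ s})`, with `H` the empirical risk. -/
def normalizedSoftMin {n p : ℕ} (β : ℝ) (s : Finset (Fin p → ℝ)) (ℓ : Fin n → ℝ → ℝ)
    (R : (Fin p → ℝ) → ℝ) (X : Fin n → Fin p → ℝ) : ℝ :=
  (1 / (n : ℝ)) * softMin β s (fun w => n * risk ℓ R w X)

/-- `g` and its derivatives up to order three are bounded. -/
def BoundedDerivs (g : ℝ → ℝ) : Prop :=
  ∀ k : Fin 4, BddAbove (Set.range fun x => |iteratedDeriv (k : ℕ) g x|)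

/-- `K_g = 1 + max_{k ≤ 3} ‖g^(k)‖_∞`, meaningful when `BoundedDerivs g` holds. -/
def Kg (g : ℝ → ℝ) : ℝ := 1 + ⨆ k : Fin 4, ⨆ x : ℝ, |iteratedDeriv (k : ℕ) g x|

/-- The average `n⁻¹ ∑ᵢ Lᵢ ^ a`. -/
def Av {n : ℕ} (Lc : Fin n → ℝ) (a : ℝ) : ℝ := (1 / (n : ℝ)) * ∑ i, Lc i ^ a

/-- The rate `p d^(3+b/2) / n^(5/2) + p d^2 / n^(3/2) + p d^(b+2) / n^((b+3)/2)`. -/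
def sigmaRate (b n p d : ℕ) : ℝ :=
  (p : ℝ) * (d : ℝ) ^ (3 + (b : ℝ) / 2) / (n : ℝ) ^ ((5 : ℝ) / 2)
    + (p : ℝ) * (d : ℝ) ^ 2 / (n : ℝ) ^ ((3 : ℝ) / 2)
    + (p : ℝ) * (d : ℝ) ^ (b + 2) / (n : ℝ) ^ (((b : ℝ) + 3) / 2)

end BlockUniversality

end

noncomputable section

namespace BlockUniversality

/-! The proof is a Lindeberg replacement at two levels: the rows of the design are exchanged one at
a time, and each row is exchanged block by block.

For fixed other rows, the smoothed minimum as a function of row `i` is `-β⁻¹ log ∑_w m_w exp (-β ℓ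
(z ⬝ᵥ w))`, the other rows and `R` being absorbed in the weights `m`. Write `z` as the sum of its
blocks and expand to second order along one block (`exists_taylor_row`). The Taylor polynomial is
affine plus quadratic in the block, so its expectation depends only on the mean and covariance,
which agree for both laws; only the third order remainder counts. The derivatives of the soft
minimum are cumulants under the Gibbs weights `m_w exp (-β ℓ)`, and by the self-bounding property
each term is at most a Gibbs average of `max 1 ℓ ^ qMax`.

These Gibbs weights still depend on the row being replaced. The decisive step is Chebyshev's
association inequality (`wavg_mul_le_of_antivary`): `exp (-β ℓ)` decreases and `max 1 ℓ ^ qMax`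
increases with `ℓ`, so dropping the factor `exp (-β ℓ)` only enlarges the average. The remaining
weights `m` are deterministic as far as the row is concerned, so the expectation passes inside the
average, and no cardinality of the index set appears.

It remains to bound `E |y ⬝ᵥ w| ^ b`, with `b = qBar = 2 m`, for a row `y` lacking one block. A
Rosenthal type inequality for even moments (`integral_sum_even_pow_le`) gives the order `L ^ b * (1
+ d ^ (m + 1) / n)`; the variance is controlled by the largest eigenvalue and the higher moments by
the block sizes. Multiplying by `n^(-3/2)` times the sum of cubed block sizes, at most `p d ^ 2`,
yields the first two terms of the rate. The part `‖z‖₁ ^ (b + 3)` of the remainder yields the third.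
The factor `1 / n` in front of the soft minimum turns the sum over rows into the average of `Lc i ^
qMax`.

All this needs a common partition for the two laws. In general the two rows are compared through a
third law (`glue`), which uses independent copies of the first row on the intersections of the
cells. It has independent blocks for both partitions, and it has the right covariance because the
common covariance vanishes between coordinates separated by either partition. -/

/-! ### Weighted averages -/

/-- The average of `f` over `s` with weights `c`. -/
def wavg {ι : Type*} (s : Finset ι) (c f : ι → ℝ) : ℝ := (∑ i ∈ s, c i * f i) / ∑ i ∈ s, c i

section wavg

variable {ι : Type*} {s : Finset ι} {c : ι → ℝ}

theorem wavg_mono (hc : ∀ i ∈ s, 0 ≤ c i) {f g : ι → ℝ} (h : ∀ i ∈ s, f i ≤ g i) :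
    wavg s c f ≤ wavg s c g :=
  div_le_div_of_nonneg_right
    (Finset.sum_le_sum fun i hi => mul_le_mul_of_nonneg_left (h i hi) (hc i hi))
    (Finset.sum_nonneg hc)

theorem wavg_nonneg (hc : ∀ i ∈ s, 0 ≤ c i) {f : ι → ℝ} (h : ∀ i ∈ s, 0 ≤ f i) :
    0 ≤ wavg s c f :=
  div_nonneg (Finset.sum_nonneg fun i hi => mul_nonneg (hc i hi) (h i hi)) (Finset.sum_nonneg hc)

theorem wavg_add (f g : ι → ℝ) :
    wavg s c (fun i => f i + g i) = wavg s c f + wavg s c g := by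
  simp only [wavg, mul_add, Finset.sum_add_distrib, add_div]

theorem wavg_const_mul (k : ℝ) (f : ι → ℝ) :
    wavg s c (fun i => k * f i) = k * wavg s c f := by
  simp only [wavg, mul_left_comm _ k, ← Finset.mul_sum, mul_div_assoc]

theorem wavg_const (hs : s.Nonempty) (hc : ∀ i ∈ s, 0 < c i) (k : ℝ) :
    wavg s c (fun _ => k) = k := by
  rw [wavg, ← Finset.sum_mul, mul_div_cancel_left₀]
  exact (Finset.sum_pos hc hs).ne'

theorem abs_wavg_le (hc : ∀ i ∈ s, 0 ≤ c i) (f : ι → ℝ) :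
    |wavg s c f| ≤ wavg s c (fun i => |f i|) := by
  rw [wavg, wavg, abs_div, abs_of_nonneg (Finset.sum_nonneg hc)]
  refine div_le_div_of_nonneg_right ?_ (Finset.sum_nonneg hc)
  refine (Finset.abs_sum_le_sum_abs _ _).trans (Finset.sum_le_sum fun i hi => ?_)
  rw [abs_mul, abs_of_nonneg (hc i hi)]

theorem wavg_le_of_le (hs : s.Nonempty) (hc : ∀ i ∈ s, 0 < c i) {f : ι → ℝ} {k : ℝ}
    (h : ∀ i ∈ s, f i ≤ k) : wavg s c f ≤ k :=
  (wavg_mono (fun i hi => (hc i hi).le) h).trans (wavg_const hs hc k).le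

/-- A product of averages is an average over pairs (two independent replicas), so a pointwise bound
on pairs suffices. This replaces Hölder's inequality; `wavg_pow_three_le` is the same with three
replicas. -/
theorem wavg_mul_wavg_le (hs : s.Nonempty) (hc : ∀ i ∈ s, 0 < c i) {f g F : ι → ℝ}
    (h : ∀ i ∈ s, ∀ j ∈ s, f i * g j ≤ F i + F j) :
    wavg s c f * wavg s c g ≤ 2 * wavg s c F := by
  have hc0 : ∀ i ∈ s, 0 ≤ c i := fun i hi => (hc i hi).le
  have h1 : ∀ i ∈ s, f i * wavg s c g ≤ F i + wavg s c F := by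
    intro i hi
    rw [← wavg_const_mul]
    refine (wavg_mono hc0 (h i hi)).trans ?_
    rw [wavg_add, wavg_const hs hc]
  calc wavg s c f * wavg s c g = wavg s c (fun i => f i * wavg s c g) := by
        rw [mul_comm, ← wavg_const_mul]
        simp only [mul_comm]
    _ ≤ wavg s c (fun i => F i + wavg s c F) := wavg_mono hc0 h1
    _ = 2 * wavg s c F := by rw [wavg_add, wavg_const hs hc]; ring

theorem wavg_pow_three_le (hs : s.Nonempty) (hc : ∀ i ∈ s, 0 < c i) {f F : ι → ℝ}
    (h : ∀ i ∈ s, ∀ j ∈ s, ∀ k ∈ s, f i * f j * f k ≤ F i + F j + F k) :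
    wavg s c f ^ 3 ≤ 3 * wavg s c F := by
  have hc0 : ∀ i ∈ s, 0 ≤ c i := fun i hi => (hc i hi).le
  have h1 : ∀ i ∈ s, ∀ j ∈ s, f i * f j * wavg s c f ≤ F i + F j + wavg s c F := by
    intro i hi j hj
    rw [← wavg_const_mul]
    refine (wavg_mono hc0 (h i hi j hj)).trans ?_
    rw [wavg_add, wavg_const hs hc]
  have h2 : ∀ i ∈ s, f i * wavg s c f * wavg s c f ≤ F i + (wavg s c F + wavg s c F) := by
    intro i hi
    rw [mul_right_comm, ← wavg_const_mul]
    have : wavg s c (fun j => f i * wavg s c f * f j)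
        ≤ wavg s c (fun j => F i + (F j + wavg s c F)) :=
      wavg_mono hc0 fun j hj => by linarith [h1 i hi j hj]
    refine this.trans ?_
    rw [wavg_add, wavg_add, wavg_const hs hc, wavg_const hs hc]
  calc wavg s c f ^ 3 = wavg s c (fun i => f i * wavg s c f * wavg s c f) := by
        simp only [mul_assoc, mul_comm (f _)]
        rw [wavg_const_mul]
        simp only [mul_comm _ (f _)]
        simp only [mul_comm (f _), wavg_const_mul]
        ring
    _ ≤ wavg s c (fun i => F i + (wavg s c F + wavg s c F)) := wavg_mono hc0 h2
    _ = 3 * wavg s c F := by rw [wavg_add, wavg_const hs hc]; ring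

/-- Chebyshev's association inequality: reweighting by `k` decreases the average of a function
that varies oppositely to `k`. -/
theorem wavg_mul_le_of_antivary {k F : ι → ℝ} (hs : s.Nonempty) (hc : ∀ i ∈ s, 0 < c i)
    (hk : ∀ i ∈ s, 0 < k i) (h : ∀ i ∈ s, ∀ j ∈ s, (k i - k j) * (F i - F j) ≤ 0) :
    wavg s (fun i => c i * k i) F ≤ wavg s c F := by
  have hpos : 0 < ∑ i ∈ s, c i := Finset.sum_pos hc hs
  have hpos' : 0 < ∑ i ∈ s, c i * k i := Finset.sum_pos (fun i hi => mul_pos (hc i hi) (hk i hi)) hs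
  rw [wavg, wavg, div_le_div_iff₀ hpos' hpos]
  -- Symmetrisation: this double sum, which is termwise nonpositive, equals twice the difference of
  -- the two sides after clearing denominators.
  have key : ∑ i ∈ s, ∑ j ∈ s, c i * c j * ((k i - k j) * (F i - F j)) ≤ 0 :=
    Finset.sum_nonpos fun i hi => Finset.sum_nonpos fun j hj =>
      mul_nonpos_of_nonneg_of_nonpos (mul_pos (hc i hi) (hc j hj)).le (h i hi j hj)
  have e : ∑ i ∈ s, ∑ j ∈ s, c i * c j * ((k i - k j) * (F i - F j))
      = 2 * ((∑ i ∈ s, c i * k i * F i) * ∑ i ∈ s, c i)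
        - 2 * ((∑ i ∈ s, c i * F i) * ∑ i ∈ s, c i * k i) := by
    have e1 : ∀ i j, c i * c j * ((k i - k j) * (F i - F j))
        = (c i * k i * F i) * c j + c i * (c j * k j * F j)
          - (c i * F i) * (c j * k j) - (c i * k i) * (c j * F j) := fun i j => by ring
    simp only [e1, Finset.sum_sub_distrib, Finset.sum_add_distrib, ← Finset.sum_mul_sum]
    ring
  linarith

/-- Derivative of a Gibbs average. -/
theorem hasDerivAt_wavg (hs : s.Nonempty) {m : ι → ℝ} (hm : ∀ i ∈ s, 0 < m i) (β : ℝ)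
    {a f : ι → ℝ → ℝ} {a' f' : ι → ℝ} {t : ℝ} (ha : ∀ i ∈ s, HasDerivAt (a i) (a' i) t)
    (hf : ∀ i ∈ s, HasDerivAt (f i) (f' i) t) :
    HasDerivAt (fun t => wavg s (fun i => m i * Real.exp (-β * a i t)) (fun i => f i t))
      (wavg s (fun i => m i * Real.exp (-β * a i t)) f'
        - β * (wavg s (fun i => m i * Real.exp (-β * a i t)) (fun i => f i t * a' i)
          - wavg s (fun i => m i * Real.exp (-β * a i t)) (fun i => f i t)
            * wavg s (fun i => m i * Real.exp (-β * a i t)) a')) t := by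
  have hZ : 0 < ∑ i ∈ s, m i * Real.exp (-β * a i t) :=
    Finset.sum_pos (fun i hi => mul_pos (hm i hi) (Real.exp_pos _)) hs
  have hc : ∀ i ∈ s, HasDerivAt (fun t => m i * Real.exp (-β * a i t))
      (m i * (Real.exp (-β * a i t) * (-β * a' i))) t := fun i hi =>
    (((ha i hi).const_mul (-β)).exp).const_mul (m i)
  have hden := HasDerivAt.fun_sum hc
  have hnum := HasDerivAt.fun_sum (fun i hi => (hc i hi).mul (hf i hi))
  have := hnum.div hden hZ.ne'
  refine this.congr_deriv ?_
  simp only [wavg, Pi.mul_apply]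
  set Z := ∑ i ∈ s, m i * Real.exp (-β * a i t)
  have e1 : ∑ i ∈ s, m i * (Real.exp (-β * a i t) * (-β * a' i))
      = -β * ∑ i ∈ s, m i * Real.exp (-β * a i t) * a' i := by
    rw [Finset.mul_sum]; exact Finset.sum_congr rfl fun i _ => by ring
  have e2 : ∑ i ∈ s, (m i * (Real.exp (-β * a i t) * (-β * a' i)) * f i t
        + m i * Real.exp (-β * a i t) * f' i)
      = -β * (∑ i ∈ s, m i * Real.exp (-β * a i t) * (f i t * a' i))
        + ∑ i ∈ s, m i * Real.exp (-β * a i t) * f' i := by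
    rw [Finset.mul_sum, ← Finset.sum_add_distrib]
    exact Finset.sum_congr rfl fun i _ => by ring
  rw [e1, e2]
  field_simp
  ring

end wavg

/-- The weighted soft minimum `-β⁻¹ log ∑ i ∈ s, m i * exp (-β * a i)`. -/
def softVal {ι : Type*} (s : Finset ι) (m : ι → ℝ) (β : ℝ) (a : ι → ℝ) : ℝ :=
  -(1 / β) * Real.log (∑ i ∈ s, m i * Real.exp (-β * a i))

theorem hasDerivAt_softVal {ι : Type*} {s : Finset ι} (hs : s.Nonempty) {m : ι → ℝ}
    (hm : ∀ i ∈ s, 0 < m i) {β : ℝ} (hβ : 0 < β) {a : ι → ℝ → ℝ} {a' : ι → ℝ} {t : ℝ}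
    (ha : ∀ i ∈ s, HasDerivAt (a i) (a' i) t) :
    HasDerivAt (fun t => softVal s m β (fun i => a i t))
      (wavg s (fun i => m i * Real.exp (-β * a i t)) a') t := by
  have hZ : 0 < ∑ i ∈ s, m i * Real.exp (-β * a i t) :=
    Finset.sum_pos (fun i hi => mul_pos (hm i hi) (Real.exp_pos _)) hs
  have hc : ∀ i ∈ s, HasDerivAt (fun t => m i * Real.exp (-β * a i t))
      (m i * (Real.exp (-β * a i t) * (-β * a' i))) t := fun i hi =>
    (((ha i hi).const_mul (-β)).exp).const_mul (m i)
  have := ((HasDerivAt.fun_sum hc).log hZ.ne').const_mul (-(1 / β))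
  refine this.congr_deriv ?_
  have e1 : ∑ i ∈ s, m i * (Real.exp (-β * a i t) * (-β * a' i))
      = -β * ∑ i ∈ s, m i * Real.exp (-β * a i t) * a' i := by
    rw [Finset.mul_sum]; exact Finset.sum_congr rfl fun i _ => by ring
  rw [e1, wavg]
  field_simp

/-- Third order Taylor estimate on the unit interval. -/
theorem abs_taylor_two_sub_le {φ φ₁ φ₂ φ₃ : ℝ → ℝ} {K : ℝ}
    (h₀ : ∀ t, HasDerivAt φ (φ₁ t) t) (h₁ : ∀ t, HasDerivAt φ₁ (φ₂ t) t)
    (h₂ : ∀ t, HasDerivAt φ₂ (φ₃ t) t) (hK : ∀ t ∈ Set.Icc (0 : ℝ) 1, |φ₃ t| ≤ K) :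
    |φ 1 - φ 0 - φ₁ 0 - φ₂ 0 / 2| ≤ K := by
  have hK0 : 0 ≤ K := (abs_nonneg _).trans (hK 0 (by simp))
  -- One integration from `0` by the mean value inequality keeps the bound `K` on the unit interval.
  -- Applying it three times loses the factor `1/6`, which is harmless.
  have step : ∀ {f f' : ℝ → ℝ}, (∀ t, HasDerivAt f (f' t) t) → f 0 = 0 →
      (∀ t ∈ Set.Icc (0 : ℝ) 1, |f' t| ≤ K) → ∀ t ∈ Set.Icc (0 : ℝ) 1, |f t| ≤ K := by
    intro f f' hf hf0 hb t ht
    have := (convex_Icc (0 : ℝ) 1).norm_image_sub_le_of_norm_hasDerivWithin_le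
      (fun x _ => (hf x).hasDerivWithinAt) hb (Set.left_mem_Icc.2 zero_le_one) ht
    rw [hf0, sub_zero, sub_zero, Real.norm_eq_abs, Real.norm_eq_abs, abs_of_nonneg ht.1] at this
    exact this.trans (mul_le_of_le_one_right hK0 ht.2)
  have s2 := step (f := fun t => φ₂ t - φ₂ 0) (fun t => (h₂ t).sub_const _) (by simp) hK
  have s1 := step (f := fun t => φ₁ t - φ₁ 0 - φ₂ 0 * t) (f' := fun t => φ₂ t - φ₂ 0)
    (fun t => (((h₁ t).sub_const (φ₁ 0)).sub ((hasDerivAt_id t).const_mul (φ₂ 0))).congr_deriv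
      (by simp)) (by simp) s2
  have s0 := step (f := fun t => φ t - φ 0 - φ₁ 0 * t - φ₂ 0 / 2 * t ^ 2)
    (f' := fun t => φ₁ t - φ₁ 0 - φ₂ 0 * t)
    (fun t => ((((h₀ t).sub_const (φ 0)).sub ((hasDerivAt_id t).const_mul (φ₁ 0))).sub
      ((hasDerivAt_pow 2 t).const_mul (φ₂ 0 / 2))).congr_deriv (by norm_num; ring)) (by simp) s1
  simpa using s0 1 (by simp)

/-! ### Third order expansion of the smoothed minimum along one block -/

/-- The second derivative of the soft minimum in terms of the derivatives of the energies. -/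
def softVal₂ {ι : Type*} (s : Finset ι) (c : ι → ℝ) (β : ℝ) (a₁ a₂ : ι → ℝ) : ℝ :=
  wavg s c a₂ - β * (wavg s c (fun i => a₁ i * a₁ i) - wavg s c a₁ * wavg s c a₁)

/-- The third derivative of the soft minimum in terms of the derivatives of the energies. -/
def softVal₃ {ι : Type*} (s : Finset ι) (c : ι → ℝ) (β : ℝ) (a₁ a₂ a₃ : ι → ℝ) : ℝ :=
  wavg s c a₃ - β * (wavg s c (fun i => a₂ i * a₁ i) - wavg s c a₂ * wavg s c a₁)
    - β * (wavg s c (fun i => a₂ i * a₁ i + a₁ i * a₂ i)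
        - β * (wavg s c (fun i => a₁ i * a₁ i * a₁ i)
          - wavg s c (fun i => a₁ i * a₁ i) * wavg s c a₁)
      - (softVal₂ s c β a₁ a₂ * wavg s c a₁ + wavg s c a₁ * softVal₂ s c β a₁ a₂))

/-- The three quantities are those occurring in the third derivative of `g (N⁻¹ G)`, namely `G₁ ^
3`, `G₁ G₂` and `G₃`. Expanded, each is a combination of products of Gibbs averages of total
differential order three, with coefficients `1`, `β`, `β ^ 2`. Products of averages involve several
replicas, hence hypotheses over distinct indices. -/
theorem abs_softVal_derivs_le {ι : Type*} {s : Finset ι} (hs : s.Nonempty) {c : ι → ℝ}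
    (hc : ∀ i ∈ s, 0 < c i) {a₁ a₂ a₃ F : ι → ℝ}
    (h111 : ∀ i ∈ s, ∀ j ∈ s, ∀ k ∈ s, |a₁ i| * |a₁ j| * |a₁ k| ≤ F i + F j + F k)
    (h12 : ∀ i ∈ s, ∀ j ∈ s, |a₁ i| * |a₂ j| ≤ F i + F j) (h3 : ∀ i ∈ s, |a₃ i| ≤ F i)
    {β : ℝ} (hβ : 0 < β) :
    |wavg s c a₁| ^ 3 ≤ 3 * (max 1 (β ^ 2) * wavg s c F) ∧
    |wavg s c a₁| * |softVal₂ s c β a₁ a₂| ≤ 9 * (max 1 (β ^ 2) * wavg s c F) ∧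
    |softVal₃ s c β a₁ a₂ a₃| ≤ 40 * (max 1 (β ^ 2) * wavg s c F) := by
  have hc0 : ∀ i ∈ s, 0 ≤ c i := fun i hi => (hc i hi).le
  have hF : ∀ i ∈ s, 0 ≤ F i := fun i hi => (abs_nonneg _).trans (h3 i hi)
  set Θ := wavg s c F with hΘ
  have hΘ0 : 0 ≤ Θ := wavg_nonneg hc0 hF
  set x := wavg s c (fun i => |a₁ i|)
  have hx0 : 0 ≤ x := wavg_nonneg hc0 fun i _ => abs_nonneg _
  have h1 : |wavg s c a₁| ≤ x := abs_wavg_le hc0 _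
  have h2 : |wavg s c a₂| ≤ wavg s c (fun i => |a₂ i|) := abs_wavg_le hc0 _
  have b111 : x ^ 3 ≤ 3 * Θ := wavg_pow_three_le hs hc h111
  have b12 : x * wavg s c (fun i => |a₂ i|) ≤ 2 * Θ := wavg_mul_wavg_le hs hc h12
  have b3 : |wavg s c a₃| ≤ Θ := (abs_wavg_le hc0 _).trans (wavg_mono hc0 h3)
  have b11' : |wavg s c (fun i => a₁ i * a₁ i)| ≤ wavg s c (fun i => |a₁ i| * |a₁ i|) := by
    refine (abs_wavg_le hc0 _).trans (le_of_eq ?_)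
    simp only [abs_mul]
  have b11 : wavg s c (fun i => |a₁ i| * |a₁ i|) * x ≤ 4 * Θ := by
    have := wavg_mul_wavg_le hs hc (f := fun i => |a₁ i| * |a₁ i|) (g := fun i => |a₁ i|)
      (F := fun i => 2 * F i) (fun i hi j hj => by linarith [h111 i hi i hi j hj, hF j hj])
    rw [wavg_const_mul] at this
    linarith
  have c11 : |wavg s c (fun i => a₁ i * a₁ i)| * |wavg s c a₁| ≤ 4 * Θ :=
    (mul_le_mul b11' h1 (abs_nonneg _) (wavg_nonneg hc0 fun i _ => by positivity)).trans b11
  have c111 : |wavg s c a₁| ^ 3 ≤ 3 * Θ := (pow_le_pow_left₀ (abs_nonneg _) h1 3).trans b111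
  have c12 : |wavg s c a₁| * |wavg s c a₂| ≤ 2 * Θ :=
    (mul_le_mul h1 h2 (abs_nonneg _) hx0).trans b12
  have d12 : |wavg s c (fun i => a₂ i * a₁ i)| ≤ 2 * Θ := by
    refine (abs_wavg_le hc0 _).trans ?_
    rw [hΘ, ← wavg_const_mul]
    refine wavg_mono hc0 fun i hi => ?_
    rw [abs_mul]; linarith [h12 i hi i hi]
  have d12' : |wavg s c (fun i => a₂ i * a₁ i + a₁ i * a₂ i)| ≤ 4 * Θ := by
    have : (fun i => a₂ i * a₁ i + a₁ i * a₂ i) = fun i => 2 * (a₂ i * a₁ i) := by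
      funext i; ring
    rw [this, wavg_const_mul, abs_mul, abs_two]; linarith
  have d111 : |wavg s c (fun i => a₁ i * a₁ i * a₁ i)| ≤ 3 * Θ := by
    refine (abs_wavg_le hc0 _).trans ?_
    rw [hΘ, ← wavg_const_mul]
    refine wavg_mono hc0 fun i hi => ?_
    rw [abs_mul, abs_mul]; linarith [h111 i hi i hi i hi]
  set y := wavg s c a₁
  set z := wavg s c a₂
  set y2 := wavg s c (fun i => a₁ i * a₁ i)
  have hB1 : (1 : ℝ) ≤ max 1 (β ^ 2) := le_max_left _ _
  have hB2 : β ^ 2 ≤ max 1 (β ^ 2) := le_max_right _ _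
  have hB3 : β ≤ max 1 (β ^ 2) := by
    rcases le_total β 1 with h | h
    · exact h.trans hB1
    · exact (by nlinarith : β ≤ β ^ 2).trans hB2
  set B := max 1 (β ^ 2)
  have e1 : Θ ≤ B * Θ := le_mul_of_one_le_left hΘ0 hB1
  have e2 : β * Θ ≤ B * Θ := mul_le_mul_of_nonneg_right hB3 hΘ0
  have e3 : β ^ 2 * Θ ≤ B * Θ := mul_le_mul_of_nonneg_right hB2 hΘ0
  have hy3 : |y * y * y| ≤ 3 * Θ := by rw [abs_mul, abs_mul]; linarith [c111, pow_succ |y| 2, sq |y|]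
  have hyz : |y * z| ≤ 2 * Θ := by rw [abs_mul]; exact c12
  have hy2y : |y2 * y| ≤ 4 * Θ := by rw [abs_mul]; exact c11
  have key : ∀ {X Y : ℝ}, |X| ≤ Y → |β * X| ≤ β * Y := fun h => by
    rw [abs_mul, abs_of_pos hβ]; exact mul_le_mul_of_nonneg_left h hβ.le
  have k2 : |y * softVal₂ s c β a₁ a₂| ≤ 2 * Θ + β * (7 * Θ) := by
    have : y * softVal₂ s c β a₁ a₂ = y * z - β * (y2 * y - y * y * y) := by
      rw [softVal₂]; ring
    rw [this]
    have h7 : |y2 * y - y * y * y| ≤ 7 * Θ := (abs_sub _ _).trans (by linarith)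
    exact (abs_sub _ _).trans (add_le_add hyz (key h7))
  refine ⟨by linarith, ?_, ?_⟩
  · rw [← abs_mul]; linarith
  · rw [softVal₃]
    have t1 : |wavg s c (fun i => a₂ i * a₁ i) - z * y| ≤ 4 * Θ :=
      (abs_sub _ _).trans (by rw [mul_comm z y]; linarith)
    have t2 : |wavg s c (fun i => a₁ i * a₁ i * a₁ i) - y2 * y| ≤ 7 * Θ :=
      (abs_sub _ _).trans (by linarith)
    have t3 : |softVal₂ s c β a₁ a₂ * y + y * softVal₂ s c β a₁ a₂|
        ≤ 2 * (2 * Θ + β * (7 * Θ)) := by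
      rw [mul_comm (softVal₂ s c β a₁ a₂) y]
      exact (abs_add_le _ _).trans (by linarith)
    have t4 := (abs_sub (wavg s c (fun i => a₂ i * a₁ i + a₁ i * a₂ i)) _).trans
      (add_le_add d12' (key t2))
    have t5 := (abs_sub _ _).trans (add_le_add t4 t3)
    refine (abs_sub _ _).trans ((add_le_add ((abs_sub _ _).trans (add_le_add b3 (key t1)))
      (key t5)).trans ?_)
    -- The accumulated bound is `Θ + 12 β Θ + 21 β ^ 2 Θ`, at most `34 B Θ`.
    nlinarith

/-- The left side is the third derivative of `g (N⁻¹ G)` in the unsimplified shape produced by the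
product rule. One factor `1 / N` is kept, the others are at most `1`, and `70 = 3 + 3 * 9 + 40`. -/
theorem abs_comp_third_deriv_le {x G₂ G₃ T K g₁ g₂ g₃ N : ℝ} (hx : |x| ^ 3 ≤ 3 * T)
    (hxG : |x| * |G₂| ≤ 9 * T) (hG : |G₃| ≤ 40 * T) (h1 : |g₁| ≤ K) (h2 : |g₂| ≤ K)
    (h3 : |g₃| ≤ K) (hN : 1 ≤ N) :
    |(g₃ * (1 / N * x) * (1 / N * x) + g₂ * (1 / N * G₂)) * (1 / N * x)
        + (g₂ * (1 / N * x)) * (1 / N * G₂)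
      + ((g₂ * (1 / N * x)) * (1 / N * G₂) + g₁ * (1 / N * G₃))| ≤ 70 * K * T / N := by
  have hK : 0 ≤ K := (abs_nonneg _).trans h1
  have hT : 0 ≤ T := by have := abs_nonneg G₃; linarith
  set r := 1 / N with hr
  have hr0 : 0 ≤ r := by positivity
  have hr1 : r ≤ 1 := by rw [hr, div_le_one (by linarith)]; exact hN
  have e : (g₃ * (r * x) * (r * x) + g₂ * (r * G₂)) * (r * x) + (g₂ * (r * x)) * (r * G₂)
      + ((g₂ * (r * x)) * (r * G₂) + g₁ * (r * G₃))
      = r * (g₃ * (r ^ 2 * (x * x * x)) + 3 * (g₂ * (r * (x * G₂))) + g₁ * G₃) := by ring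
  have b1 : |g₃ * (r ^ 2 * (x * x * x))| ≤ K * (3 * T) := by
    rw [abs_mul]
    refine mul_le_mul h3 ?_ (abs_nonneg _) hK
    rw [abs_mul, abs_of_nonneg (by positivity : 0 ≤ r ^ 2)]
    have : |x * x * x| ≤ 3 * T := by rw [abs_mul, abs_mul]; linarith [pow_succ |x| 2, sq |x|]
    exact (mul_le_of_le_one_left (abs_nonneg _) (pow_le_one₀ hr0 hr1)).trans this
  have b2 : |g₂ * (r * (x * G₂))| ≤ K * (9 * T) := by
    rw [abs_mul]
    refine mul_le_mul h2 ?_ (abs_nonneg _) hK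
    rw [abs_mul, abs_of_nonneg hr0]
    have : |x * G₂| ≤ 9 * T := by rw [abs_mul]; exact hxG
    exact (mul_le_of_le_one_left (abs_nonneg _) hr1).trans this
  have b3 : |g₁ * G₃| ≤ K * (40 * T) := by
    rw [abs_mul]; exact mul_le_mul h1 hG (abs_nonneg _) hK
  rw [e, abs_mul, abs_of_nonneg hr0]
  have b : |g₃ * (r ^ 2 * (x * x * x)) + 3 * (g₂ * (r * (x * G₂))) + g₁ * G₃| ≤ 70 * K * T := by
    refine (abs_add_le _ _).trans ((add_le_add_left (abs_add_le _ _) _).trans ?_)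
    rw [abs_mul 3, abs_of_pos (by norm_num : (0 : ℝ) < 3)]
    linarith
  calc r * _ ≤ r * (70 * K * T) := mul_le_mul_of_nonneg_left b hr0
    _ = 70 * K * T / N := by rw [hr]; ring

/-- A loss function together with its derivatives, bounded in terms of powers of the loss. -/
structure SelfBounded (ℓ ℓ₁ ℓ₂ ℓ₃ : ℝ → ℝ) (Q D : ℝ) : Prop where
  deriv₁ : ∀ x, HasDerivAt ℓ (ℓ₁ x) x
  deriv₂ : ∀ x, HasDerivAt ℓ₁ (ℓ₂ x) x
  deriv₃ : ∀ x, HasDerivAt ℓ₂ (ℓ₃ x) x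
  bound₁₁₁ : ∀ x y z, |ℓ₁ x| * |ℓ₁ y| * |ℓ₁ z|
    ≤ D * (max 1 (ℓ x) ^ Q + max 1 (ℓ y) ^ Q + max 1 (ℓ z) ^ Q)
  bound₁₂ : ∀ x y, |ℓ₁ x| * |ℓ₂ y| ≤ D * (max 1 (ℓ x) ^ Q + max 1 (ℓ y) ^ Q)
  bound₃ : ∀ x, |ℓ₃ x| ≤ D * max 1 (ℓ x) ^ Q

/-- The coefficients depend on the base point `u` only, so the polynomial can be integrated against
any law of the increment `v`. In the bound, `T` controls averages with the bare weights `m`, not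
with the Gibbs weights along the segment; this is the gain from the association inequality. -/
theorem exists_taylor_row {ι : Type*} {s : Finset ι} (hs : s.Nonempty) {m : ι → ℝ}
    (hm : ∀ i ∈ s, 0 < m i) {β : ℝ} (hβ : 0 < β) {ℓ ℓ₁ ℓ₂ ℓ₃ : ℝ → ℝ} {Q D : ℝ} (hQ : 0 ≤ Q)
    (hD : 0 ≤ D) (hℓ : SelfBounded ℓ ℓ₁ ℓ₂ ℓ₃ Q D) {g g₁ g₂ g₃ : ℝ → ℝ} {K : ℝ}
    (hg₁ : ∀ x, HasDerivAt g (g₁ x) x) (hg₂ : ∀ x, HasDerivAt g₁ (g₂ x) x)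
    (hg₃ : ∀ x, HasDerivAt g₂ (g₃ x) x) (hK₁ : ∀ x, |g₁ x| ≤ K) (hK₂ : ∀ x, |g₂ x| ≤ K)
    (hK₃ : ∀ x, |g₃ x| ≤ K) {N : ℝ} (hN : 1 ≤ N) (u : ι → ℝ) :
    ∃ (A B γ : ℝ) (e c : ι → ℝ), ∀ (v : ι → ℝ) (V T : ℝ), (∀ i ∈ s, |v i| ≤ V) →
      (∀ t ∈ Set.Icc (0 : ℝ) 1, wavg s m (fun i => max 1 (ℓ (u i + t * v i)) ^ Q) ≤ T) →
      |g (1 / N * softVal s m β (fun i => ℓ (u i + v i)))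
        - (A + B * ∑ i ∈ s, e i * v i + (∑ i ∈ s, c i * v i ^ 2 + γ * (∑ i ∈ s, e i * v i) ^ 2))|
      ≤ 70 * K * max 1 (β ^ 2) * D * V ^ 3 * T / N := by
  set Z := ∑ i ∈ s, m i * Real.exp (-β * ℓ (u i)) with hZ
  set y₀ := 1 / N * softVal s m β (fun i => ℓ (u i)) with hy₀
  -- The sum of `e i * v i` is the Gibbs mean of `ℓ₁ v`. The second derivative is a Gibbs mean of
  -- `(ℓ₂ - β ℓ₁ ^ 2) v ^ 2`, giving `c`, plus the square of that first mean, coming from the Gibbs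
  -- variance and from `g₂`, giving `γ`.
  refine ⟨g y₀, g₁ y₀ * (1 / N), (g₂ y₀ * (1 / N) ^ 2 + g₁ y₀ * (1 / N) * β) / 2,
    fun i => m i * Real.exp (-β * ℓ (u i)) * ℓ₁ (u i) / Z,
    fun i => g₁ y₀ * (1 / N) / 2 *
      (m i * Real.exp (-β * ℓ (u i)) * (ℓ₂ (u i) - β * ℓ₁ (u i) ^ 2) / Z), ?_⟩
  intro v V T hv hT
  set a : ι → ℝ → ℝ := fun i t => ℓ (u i + t * v i) with ha
  set a₁ : ι → ℝ → ℝ := fun i t => ℓ₁ (u i + t * v i) * v i with ha₁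
  set a₂ : ι → ℝ → ℝ := fun i t => ℓ₂ (u i + t * v i) * v i * v i with ha₂
  set a₃ : ι → ℝ → ℝ := fun i t => ℓ₃ (u i + t * v i) * v i * v i * v i with ha₃
  set c : ℝ → ι → ℝ := fun t i => m i * Real.exp (-β * a i t) with hcdef
  have hc : ∀ t, ∀ i ∈ s, 0 < c t i := fun t i hi => mul_pos (hm i hi) (Real.exp_pos _)
  have hlin : ∀ i t, HasDerivAt (fun t => u i + t * v i) (v i) t := fun i t => by
    simpa using ((hasDerivAt_id t).mul_const (v i)).const_add (u i)
  have da : ∀ t, ∀ i ∈ s, HasDerivAt (a i) (a₁ i t) t := fun t i _ =>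
    (hℓ.deriv₁ _).comp t (hlin i t)
  have da₁ : ∀ t, ∀ i ∈ s, HasDerivAt (a₁ i) (a₂ i t) t := fun t i _ =>
    ((hℓ.deriv₂ _).comp t (hlin i t)).mul_const (v i)
  have da₂ : ∀ t, ∀ i ∈ s, HasDerivAt (a₂ i) (a₃ i t) t := fun t i _ =>
    (((hℓ.deriv₃ _).comp t (hlin i t)).mul_const (v i)).mul_const (v i)
  set G : ℝ → ℝ := fun t => softVal s m β (fun i => a i t) with hG
  set G₁ : ℝ → ℝ := fun t => wavg s (c t) (fun i => a₁ i t) with hG₁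
  set G₂ : ℝ → ℝ := fun t => softVal₂ s (c t) β (fun i => a₁ i t) (fun i => a₂ i t) with hG₂
  set G₃ : ℝ → ℝ := fun t =>
    softVal₃ s (c t) β (fun i => a₁ i t) (fun i => a₂ i t) (fun i => a₃ i t) with hG₃
  have dG : ∀ t, HasDerivAt G (G₁ t) t := fun t => hasDerivAt_softVal hs hm hβ (da t)
  have dG₁ : ∀ t, HasDerivAt G₁ (G₂ t) t := fun t => hasDerivAt_wavg hs hm β (da t) (da₁ t)
  have dG₂ : ∀ t, HasDerivAt G₂ (G₃ t) t := fun t => by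
    have e2 := hasDerivAt_wavg hs hm β (da t) (da₂ t)
    have e11 := hasDerivAt_wavg hs hm β (da t)
      (fun i hi => (da₁ t i hi).mul (da₁ t i hi))
    have e1 := dG₁ t
    exact e2.sub ((e11.sub (e1.mul e1)).const_mul β)
  have dg : ∀ {f f' : ℝ → ℝ}, (∀ x, HasDerivAt f (f' x) x) → ∀ t,
      HasDerivAt (fun t => f (1 / N * G t)) (f' (1 / N * G t) * (1 / N * G₁ t)) t :=
    fun hf t => (hf _).comp t ((dG t).const_mul (1 / N))
  set φ : ℝ → ℝ := fun t => g (1 / N * G t) with hφ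
  set φ₁ : ℝ → ℝ := fun t => g₁ (1 / N * G t) * (1 / N * G₁ t) with hφ₁
  set φ₂ : ℝ → ℝ := fun t => g₂ (1 / N * G t) * (1 / N * G₁ t) * (1 / N * G₁ t)
    + g₁ (1 / N * G t) * (1 / N * G₂ t) with hφ₂
  have d₀ : ∀ t, HasDerivAt φ (φ₁ t) t := dg hg₁
  have d₁ : ∀ t, HasDerivAt φ₁ (φ₂ t) t := fun t =>
    (dg hg₂ t).mul ((dG₁ t).const_mul (1 / N))
  have d₂ := fun t => (((dg hg₃ t).mul ((dG₁ t).const_mul (1 / N))).mul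
      ((dG₁ t).const_mul (1 / N))).add ((dg hg₂ t).mul ((dG₂ t).const_mul (1 / N)))
  have hV0 : 0 ≤ V := by obtain ⟨i, hi⟩ := hs; exact (abs_nonneg _).trans (hv i hi)
  have hN0 : 0 < N := by linarith
  have hK0 : 0 ≤ K := (abs_nonneg _).trans (hK₁ 0)
  have main := abs_taylor_two_sub_le d₀ d₁ d₂
    (K := 70 * K * max 1 (β ^ 2) * D * V ^ 3 * T / N) ?_
  · have E0 : φ 0 = g y₀ := by simp [hφ, hG, ha, hy₀]
    have E1 : φ 1 = g (1 / N * softVal s m β (fun i => ℓ (u i + v i))) := by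
      simp [hφ, hG, ha]
    have hG10 : G₁ 0 = ∑ i ∈ s, m i * Real.exp (-β * ℓ (u i)) * ℓ₁ (u i) / Z * v i := by
      simp only [hG₁, wavg, hcdef, ha, ha₁, zero_mul, add_zero, Finset.sum_div]
      exact Finset.sum_congr rfl fun i _ => by rw [← hZ]; ring
    have hG20 : G₂ 0 = ∑ i ∈ s, (m i * Real.exp (-β * ℓ (u i)) *
        (ℓ₂ (u i) - β * ℓ₁ (u i) ^ 2) / Z) * v i ^ 2 + β * G₁ 0 ^ 2 := by
      simp only [hG₂, softVal₂]
      have : wavg s (c 0) (fun i => a₂ i 0) - β * wavg s (c 0) (fun i => a₁ i 0 * a₁ i 0)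
          = ∑ i ∈ s, (m i * Real.exp (-β * ℓ (u i)) *
            (ℓ₂ (u i) - β * ℓ₁ (u i) ^ 2) / Z) * v i ^ 2 := by
        simp only [wavg, hcdef, ha, ha₁, ha₂, zero_mul, add_zero, Finset.sum_div]
        rw [← hZ, Finset.mul_sum, ← Finset.sum_sub_distrib]
        exact Finset.sum_congr rfl fun i _ => by ring
      rw [← this, hG₁]; ring
    have E3 : φ₁ 0 = g₁ y₀ * (1 / N) * G₁ 0 := by
      simp only [hφ₁, hG, ha, hy₀, zero_mul, add_zero]; ring
    have E4 : φ₂ 0 / 2 = ∑ i ∈ s, g₁ y₀ * (1 / N) / 2 *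
      (m i * Real.exp (-β * ℓ (u i)) * (ℓ₂ (u i) - β * ℓ₁ (u i) ^ 2) / Z) * v i ^ 2
        + (g₂ y₀ * (1 / N) ^ 2 + g₁ y₀ * (1 / N) * β) / 2 * G₁ 0 ^ 2 := by
      simp only [mul_assoc (g₁ y₀ * (1 / N) / 2), ← Finset.mul_sum]
      have : φ₂ 0 = g₂ y₀ * (1 / N * G₁ 0) * (1 / N * G₁ 0) + g₁ y₀ * (1 / N * G₂ 0) := by
        simp only [hφ₂, hG, ha, hy₀, zero_mul, add_zero]
      rw [this, hG20]; ring
    rw [← hG10, ← E1, ← E0, ← E3, ← E4]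
    convert main using 2
    ring
  · intro t ht
    -- Every product to be bounded has differential order three in `t`, hence carries exactly three
    -- factors `v`, which give `V ^ 3`.
    have hF := abs_softVal_derivs_le hs (hc t) (a₁ := fun i => a₁ i t) (a₂ := fun i => a₂ i t)
      (a₃ := fun i => a₃ i t) (F := fun i => D * V ^ 3 * max 1 (a i t) ^ Q) ?_ ?_ ?_ hβ
    · have hΘ : wavg s (c t) (fun i => D * V ^ 3 * max 1 (a i t) ^ Q) ≤ D * V ^ 3 * T := by
        rw [wavg_const_mul]
        refine mul_le_mul_of_nonneg_left (le_trans ?_ (hT t ht)) (by positivity)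
        -- The row's own Gibbs factor is decreasing in the energy and the averaged function is
        -- increasing, so the factor can be dropped.
        refine wavg_mul_le_of_antivary hs hm (fun i _ => Real.exp_pos _) fun i _ j _ => ?_
        have hmono : ∀ {x y : ℝ}, x ≤ y → max 1 x ^ Q ≤ max 1 y ^ Q := fun h =>
          Real.rpow_le_rpow (by positivity) (max_le_max le_rfl h) hQ
        have hanti : ∀ {x y : ℝ}, x ≤ y → Real.exp (-β * y) ≤ Real.exp (-β * x) := fun h =>
          Real.exp_le_exp.2 (by nlinarith)
        rcases le_total (a i t) (a j t) with h | h
        · exact mul_nonpos_of_nonneg_of_nonpos (sub_nonneg.2 (hanti h)) (sub_nonpos.2 (hmono h))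
        · exact mul_nonpos_of_nonpos_of_nonneg (sub_nonpos.2 (hanti h)) (sub_nonneg.2 (hmono h))
      refine (abs_comp_third_deriv_le hF.1 hF.2.1 hF.2.2 (hK₁ _) (hK₂ _) (hK₃ _) hN).trans ?_
      refine div_le_div_of_nonneg_right ?_ hN0.le
      calc _ ≤ 70 * K * (max 1 (β ^ 2) * (D * V ^ 3 * T)) := by gcongr
        _ = _ := by ring
    · intro i hi j hj k hk
      simp only [ha₁, abs_mul]
      have hvvv : |v i| * |v j| * |v k| ≤ V ^ 3 := by
        calc |v i| * |v j| * |v k| ≤ V * V * V := by gcongr <;> apply hv <;> assumption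
          _ = V ^ 3 := by ring
      have := mul_le_mul (hℓ.bound₁₁₁ (u i + t * v i) (u j + t * v j) (u k + t * v k)) hvvv
        (by positivity) (by positivity)
      linarith
    · intro i hi j hj
      simp only [ha₁, ha₂, abs_mul]
      have hvvv : |v i| * |v j| * |v j| ≤ V ^ 3 := by
        calc |v i| * |v j| * |v j| ≤ V * V * V := by gcongr <;> apply hv <;> assumption
          _ = V ^ 3 := by ring
      have := mul_le_mul (hℓ.bound₁₂ (u i + t * v i) (u j + t * v j)) hvvv
        (by positivity) (by positivity)
      linarith
    · intro i hi
      simp only [ha₃, abs_mul]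
      have hvvv : |v i| * |v i| * |v i| ≤ V ^ 3 := by
        calc |v i| * |v i| * |v i| ≤ V * V * V := by gcongr <;> apply hv <;> assumption
          _ = V ^ 3 := by ring
      have := mul_le_mul (hℓ.bound₃ (u i + t * v i)) hvvv
        (by positivity) (by positivity)
      linarith

/-! ### Consequences of the assumption on the losses -/

theorem hasDerivAt_iteratedDeriv {f : ℝ → ℝ} (hf : ContDiff ℝ 3 f) {k : ℕ} (hk : k < 3) (x : ℝ) :
    HasDerivAt (iteratedDeriv k f) (iteratedDeriv (k + 1) f x) x := by
  rw [iteratedDeriv_succ]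
  exact ((hf.differentiable_iteratedDeriv k (by exact_mod_cast hk)) x).hasDerivAt

theorem le_qBar (q : Fin 4 → ℝ) : q 0 * qMax q ≤ (qBar q : ℝ) := by
  have := Nat.le_ceil (q 0 * qMax q / 2)
  rw [qBar]; push_cast; linarith

theorem qMax_nonneg {q : Fin 4 → ℝ} (hq : ∀ k, 0 ≤ q k) : 0 ≤ qMax q :=
  (hq 3).trans ((le_max_right _ _).trans (le_max_right _ _))

theorem rpow_le_rpow_max_one {x r Q : ℝ} (h : r ≤ Q) : max 1 x ^ r ≤ max 1 x ^ Q :=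
  Real.rpow_le_rpow_of_exponent_le (le_max_left _ _) h

/-- Each derivative is at most `2 * D ρ * max 1 ℓ ^ q k`. In a product, all arguments are replaced
by the largest one; the exponents add up to `3 q₁`, `q₁ + q₂` or `q₃`, which explains `qMax`. A
power of the largest argument is one of the summands on the right. -/
theorem LossAssumption.selfBounded {q : Fin 4 → ℝ} {n : ℕ} {ℓ : Fin n → ℝ → ℝ}
    {ℓs : Fin n → ℝ → ℝ → ℝ} {ρbar : ℝ} {Lc : Fin n → ℝ} {D A : ℝ → ℝ}
    (H : LossAssumption q ℓ ℓs ρbar Lc D A) (i : Fin n) {ρ : ℝ} (hρ : ρ ∈ Set.Ioo 0 ρbar) :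
    SelfBounded (ℓs i ρ) (iteratedDeriv 1 (ℓs i ρ)) (iteratedDeriv 2 (ℓs i ρ))
      (iteratedDeriv 3 (ℓs i ρ)) (qMax q) (8 * D ρ ^ 3) := by
  have hD : 1 ≤ D ρ := H.one_le_D ρ hρ
  have hD3 : D ρ ≤ D ρ ^ 3 := le_self_pow₀ hD (by norm_num)
  have hD23 : D ρ ^ 2 ≤ D ρ ^ 3 := pow_le_pow_right₀ hD (by norm_num)
  have hcd := H.smooth_contDiff i ρ hρ
  have hU : ∀ x, 0 < max 1 (ℓs i ρ x) := fun x => by positivity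
  have hb : ∀ k : Fin 4, k ≠ 0 → ∀ x, |iteratedDeriv (k : ℕ) (ℓs i ρ) x|
      ≤ 2 * D ρ * max 1 (ℓs i ρ x) ^ q k := by
    intro k hk x
    have h0 := H.smooth_nonneg i ρ hρ x
    have h1 := H.self_bounding k hk i ρ hρ x
    rw [abs_of_nonneg h0, div_le_iff₀ (by positivity)] at h1
    refine h1.trans ?_
    have h2 : (1 : ℝ) ≤ max 1 (ℓs i ρ x) ^ q k :=
      Real.one_le_rpow (le_max_left _ _) (H.q_nonneg k)
    have h3 : ℓs i ρ x ^ q k ≤ max 1 (ℓs i ρ x) ^ q k :=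
      Real.rpow_le_rpow h0 (le_max_right _ _) (H.q_nonneg k)
    nlinarith
  have b1 := hb 1 (by decide)
  have b2 := hb 2 (by decide)
  have b3 := hb 3 (by decide)
  have hQ1 : 3 * q 1 ≤ qMax q := le_max_left _ _
  have hQ2 : q 1 + q 2 ≤ qMax q := (le_max_left _ _).trans (le_max_right _ _)
  have hQ3 : q 3 ≤ qMax q := (le_max_right _ _).trans (le_max_right _ _)
  have hP : ∀ x, 0 ≤ max 1 (ℓs i ρ x) ^ qMax q := fun x => by positivity
  refine ⟨fun x => ?_, hasDerivAt_iteratedDeriv hcd (by norm_num),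
    hasDerivAt_iteratedDeriv hcd (by norm_num), fun x y z => ?_, fun x y => ?_, fun x => ?_⟩
  · simpa using hasDerivAt_iteratedDeriv hcd (k := 0) (by norm_num) x
  · have hq1 := H.q_nonneg 1
    set u := max 1 (ℓs i ρ x)
    set v := max 1 (ℓs i ρ y)
    set w := max 1 (ℓs i ρ z)
    have hm1 : (1 : ℝ) ≤ max u (max v w) := (le_max_left _ _).trans (le_max_left u _)
    have key : u ^ q 1 * v ^ q 1 * w ^ q 1 ≤ u ^ qMax q + v ^ qMax q + w ^ qMax q := by
      calc u ^ q 1 * v ^ q 1 * w ^ q 1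
          ≤ max u (max v w) ^ q 1 * max u (max v w) ^ q 1 * max u (max v w) ^ q 1 := by
            gcongr
            · exact le_max_left _ _
            · exact (le_max_left _ _).trans (le_max_right _ _)
            · exact (le_max_right _ _).trans (le_max_right _ _)
        _ = max u (max v w) ^ (3 * q 1) := by
            rw [← Real.rpow_add (by linarith), ← Real.rpow_add (by linarith)]; ring_nf
        _ ≤ max u (max v w) ^ qMax q := Real.rpow_le_rpow_of_exponent_le hm1 hQ1
        _ ≤ _ := by
            rcases max_choice u (max v w) with h | h <;> rw [h]
            · linarith [hP x, hP y, hP z]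
            · rcases max_choice v w with h | h <;> rw [h] <;> linarith [hP x, hP y, hP z]
    calc _ ≤ (2 * D ρ * u ^ q 1) * (2 * D ρ * v ^ q 1) * (2 * D ρ * w ^ q 1) := by
          gcongr <;> apply b1
      _ = 8 * D ρ ^ 3 * (u ^ q 1 * v ^ q 1 * w ^ q 1) := by ring
      _ ≤ _ := mul_le_mul_of_nonneg_left key (by positivity)
  · have hq1 := H.q_nonneg 1
    have hq2 := H.q_nonneg 2
    set u := max 1 (ℓs i ρ x)
    set v := max 1 (ℓs i ρ y)
    have hm1 : (1 : ℝ) ≤ max u v := (le_max_left _ _).trans (le_max_left u _)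
    have key : u ^ q 1 * v ^ q 2 ≤ u ^ qMax q + v ^ qMax q := by
      calc u ^ q 1 * v ^ q 2 ≤ max u v ^ q 1 * max u v ^ q 2 := by
            gcongr
            · exact le_max_left _ _
            · exact le_max_right _ _
        _ = max u v ^ (q 1 + q 2) := by rw [← Real.rpow_add (by linarith)]
        _ ≤ max u v ^ qMax q := Real.rpow_le_rpow_of_exponent_le hm1 hQ2
        _ ≤ _ := by rcases max_choice u v with h | h <;> rw [h] <;> linarith [hP x, hP y]
    calc _ ≤ (2 * D ρ * u ^ q 1) * (2 * D ρ * v ^ q 2) := by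
          gcongr
          · apply b1
          · apply b2
      _ = 4 * D ρ ^ 2 * (u ^ q 1 * v ^ q 2) := by ring
      _ ≤ 8 * D ρ ^ 3 * (u ^ q 1 * v ^ q 2) :=
          mul_le_mul_of_nonneg_right (by nlinarith) (mul_nonneg (by positivity) (by positivity))
      _ ≤ _ := mul_le_mul_of_nonneg_left key (by positivity)
  · refine (b3 x).trans (mul_le_mul (by linarith) (rpow_le_rpow_max_one hQ3) (by positivity)
      (by positivity))

/-- Since the approximation error is at most `1`, the smoothed loss inherits growth of order `q₀`.
The exponent `q₀ qMax` is then rounded up to the even integer `qBar`, so that moments of sums can be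
computed by expanding powers. -/
theorem LossAssumption.max_one_rpow_le {q : Fin 4 → ℝ} {n : ℕ} {ℓ : Fin n → ℝ → ℝ}
    {ℓs : Fin n → ℝ → ℝ → ℝ} {ρbar : ℝ} {Lc : Fin n → ℝ} {D A : ℝ → ℝ}
    (H : LossAssumption q ℓ ℓs ρbar Lc D A) (i : Fin n) {ρ : ℝ} (hρ : ρ ∈ Set.Ioo 0 ρbar)
    (x : ℝ) :
    max 1 (ℓs i ρ x) ^ qMax q ≤ 3 ^ qMax q * Lc i ^ qMax q * (1 + |x| ^ qBar q) := by
  have hQ := qMax_nonneg H.q_nonneg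
  have hL := H.one_le_Lc i
  have hx1 : (1 : ℝ) ≤ max 1 |x| := le_max_left _ _
  have hpow1 : (1 : ℝ) ≤ max 1 |x| ^ q 0 := Real.one_le_rpow hx1 (H.q_nonneg 0)
  have h1 : max 1 (ℓs i ρ x) ≤ 3 * Lc i * max 1 |x| ^ q 0 := by
    have h3 : |x| ^ q 0 ≤ max 1 |x| ^ q 0 :=
      Real.rpow_le_rpow (abs_nonneg _) (le_max_right _ _) (H.q_nonneg 0)
    have h4 : |ℓ i x| ≤ Lc i * (1 + |x| ^ q 0) := by
      have := H.growth i x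
      rwa [div_le_iff₀ (by positivity)] at this
    have h5 := H.approx i ρ hρ x
    have h6 := H.A_le_one ρ hρ
    have h7 : ℓs i ρ x ≤ 1 + Lc i * (1 + |x| ^ q 0) := by
      have := abs_le.1 h5
      have := le_abs_self (ℓ i x)
      linarith
    refine max_le ?_ ?_ <;> nlinarith
  calc max 1 (ℓs i ρ x) ^ qMax q ≤ (3 * Lc i * max 1 |x| ^ q 0) ^ qMax q :=
        Real.rpow_le_rpow (by positivity) h1 hQ
    _ = 3 ^ qMax q * Lc i ^ qMax q * max 1 |x| ^ (q 0 * qMax q) := by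
        rw [Real.mul_rpow (by positivity) (by positivity), Real.mul_rpow (by norm_num)
          (by linarith), ← Real.rpow_mul (by positivity)]
    _ ≤ 3 ^ qMax q * Lc i ^ qMax q * max 1 |x| ^ (qBar q : ℝ) :=
        mul_le_mul_of_nonneg_left (Real.rpow_le_rpow_of_exponent_le hx1 (le_qBar q))
          (mul_nonneg (by positivity) (Real.rpow_nonneg (by linarith) _))
    _ ≤ _ := by
        refine mul_le_mul_of_nonneg_left ?_
          (mul_nonneg (by positivity) (Real.rpow_nonneg (by linarith) _))
        rw [Real.rpow_natCast]
        rcases max_choice 1 |x| with h | h <;> rw [h]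
        · rw [one_pow]; linarith [pow_nonneg (abs_nonneg x) (qBar q)]
        · linarith

/-! ### Replacing the law of one block -/

/-- `μ` is the law of a centred random vector whose `ℓ¹`-norm has `k`-th moment at most `v ^ k`
for `k ≤ r`. -/
structure IsBlockLaw {p : ℕ} (μ : Measure (Fin p → ℝ)) (r : ℕ) (v : ℝ) : Prop where
  memLp : ∀ j, MemLp (fun z : Fin p → ℝ => z j) r μ
  mean : ∀ w : Fin p → ℝ, ∫ z, z ⬝ᵥ w ∂μ = 0
  moment : ∀ k ≤ r, ∫ z, (∑ j, |z j|) ^ k ∂μ ≤ v ^ k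

theorem integrable_pow_of_memLp {Ω : Type*} [MeasurableSpace Ω] {μ : Measure Ω}
    [IsProbabilityMeasure μ] {f : Ω → ℝ} {r k : ℕ} (hf : MemLp f r μ) (hk : k ≤ r) :
    Integrable (fun ω => f ω ^ k) μ := by
  have h : MemLp f k μ := hf.mono_exponent (by exact_mod_cast hk)
  have hm : AEStronglyMeasurable (fun ω => f ω ^ k) μ := hf.1.pow k
  refine (integrable_norm_iff hm).1 ?_
  simpa only [norm_pow] using h.integrable_norm_pow'

section

variable {p : ℕ} {μ ν : Measure (Fin p → ℝ)}

theorem memLp_dotProduct {r : ℕ} (h : ∀ j, MemLp (fun z : Fin p → ℝ => z j) r μ)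
    (w : Fin p → ℝ) : MemLp (fun z => z ⬝ᵥ w) r μ := by
  have := memLp_finsetSum (s := Finset.univ) (f := fun j (z : Fin p → ℝ) => w j * z j)
    fun j _ => (h j).const_mul (w j)
  refine this.congr_norm (by fun_prop) (Filter.Eventually.of_forall fun z => ?_)
  simp [dotProduct, mul_comm]

theorem memLp_l1 {r : ℕ} (h : ∀ j, MemLp (fun z : Fin p → ℝ => z j) r μ) :
    MemLp (fun z : Fin p → ℝ => ∑ j, |z j|) r μ :=
  memLp_finsetSum Finset.univ fun j _ => (h j).norm

theorem abs_dotProduct_le_l1 {L : ℝ} {w : Fin p → ℝ} (hw : ∀ j, w j ∈ Set.Icc (-L) L)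
    (z : Fin p → ℝ) : |z ⬝ᵥ w| ≤ L * ∑ j, |z j| := by
  rw [dotProduct, Finset.mul_sum]
  refine (Finset.abs_sum_le_sum_abs _ _).trans (Finset.sum_le_sum fun j _ => ?_)
  rw [abs_mul, mul_comm]
  exact mul_le_mul_of_nonneg_right (abs_le.2 (hw j)) (abs_nonneg _)

theorem abs_integral_sub_le_of_approx {Ω : Type*} [MeasurableSpace Ω] {μ ν : Measure Ω}
    {f P R : Ω → ℝ} (hf : Integrable f μ) (hf' : Integrable f ν) (hP : Integrable P μ)
    (hP' : Integrable P ν) (hR : Integrable R μ) (hR' : Integrable R ν)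
    (hPP : ∫ z, P z ∂μ = ∫ z, P z ∂ν) (h : ∀ z, |f z - P z| ≤ R z) :
    |∫ z, f z ∂μ - ∫ z, f z ∂ν| ≤ ∫ z, R z ∂μ + ∫ z, R z ∂ν := by
  have e : ∫ z, f z ∂μ - ∫ z, f z ∂ν = ∫ z, (f z - P z) ∂μ - ∫ z, (f z - P z) ∂ν := by
    rw [integral_sub hf hP, integral_sub hf' hP', hPP]; ring
  rw [e]
  refine (abs_sub _ _).trans (add_le_add ?_ ?_)
  · exact abs_integral_le_integral_abs.trans (integral_mono (hf.sub hP).abs hR h)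
  · exact abs_integral_le_integral_abs.trans (integral_mono (hf'.sub hP').abs hR' h)

/-- The smoothed minimum as a function of one row. -/
def rowFun (g : ℝ → ℝ) (N : ℝ) (s : Finset (Fin p → ℝ)) (m : (Fin p → ℝ) → ℝ) (β : ℝ)
    (ℓ : ℝ → ℝ) (z : Fin p → ℝ) : ℝ :=
  g (1 / N * softVal s m β fun w => ℓ (z ⬝ᵥ w))

theorem continuous_rowFun {g : ℝ → ℝ} (hg : Continuous g) (N : ℝ) {s : Finset (Fin p → ℝ)}
    (hs : s.Nonempty) {m : (Fin p → ℝ) → ℝ} (hm : ∀ w ∈ s, 0 < m w) (β : ℝ) {ℓ : ℝ → ℝ}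
    (hℓ : Continuous ℓ) : Continuous (rowFun g N s m β ℓ) := by
  have h1 : ∀ w : Fin p → ℝ, Continuous fun z : Fin p → ℝ => z ⬝ᵥ w := fun w => by
    unfold dotProduct; fun_prop
  refine hg.comp (continuous_const.mul (continuous_const.mul (Continuous.log ?_ fun z => ?_)))
  · exact continuous_finsetSum _ fun w _ => continuous_const.mul
      (Real.continuous_exp.comp (continuous_const.mul (hℓ.comp (h1 w))))
  · exact (Finset.sum_pos (fun w hw => mul_pos (hm w hw) (Real.exp_pos _)) hs).ne'

theorem integrable_of_continuous_of_bounded {E : Type*} [TopologicalSpace E] [MeasurableSpace E]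
    [OpensMeasurableSpace E] {μ : Measure E} [IsFiniteMeasure μ] {f : E → ℝ} (hf : Continuous f)
    {K : ℝ} (hK : ∀ x, |f x| ≤ K) : Integrable f μ :=
  .of_bound (hf.measurable.aestronglyMeasurable) K (Filter.Eventually.of_forall hK)

/-- The swap of a single block `z` added to the rest `y` of the row. The Taylor polynomial has the
same integral under both laws. The remainder is evaluated with `V = L ‖z‖₁` and `T` of order `1 + Y
+ V ^ b`, whence the powers `3` and `b + 3`; `140 = 2 * 70` since each law contributes once. -/
theorem abs_integral_rowFun_sub_le [IsProbabilityMeasure μ] [IsProbabilityMeasure ν] {b : ℕ}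
    {v : ℝ} (hμ : IsBlockLaw μ (b + 3) v) (hν : IsBlockLaw ν (b + 3) v)
    (hcov : ∀ w : Fin p → ℝ, ∫ z, (z ⬝ᵥ w) ^ 2 ∂μ = ∫ z, (z ⬝ᵥ w) ^ 2 ∂ν)
    {s : Finset (Fin p → ℝ)} (hs : s.Nonempty) {m : (Fin p → ℝ) → ℝ} (hm : ∀ w ∈ s, 0 < m w)
    {L : ℝ} (hL : 0 ≤ L) (hw : ∀ w ∈ s, ∀ j, w j ∈ Set.Icc (-L) L)
    {β : ℝ} (hβ : 0 < β) {ℓ ℓ₁ ℓ₂ ℓ₃ : ℝ → ℝ} {Q D : ℝ} (hQ : 0 ≤ Q)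
    (hD : 0 ≤ D) (hℓ : SelfBounded ℓ ℓ₁ ℓ₂ ℓ₃ Q D) {H : ℝ} (hH : 0 ≤ H)
    (hℓH : ∀ x, max 1 (ℓ x) ^ Q ≤ H * (1 + |x| ^ b)) {g g₁ g₂ g₃ : ℝ → ℝ} {K : ℝ}
    (hg₁ : ∀ x, HasDerivAt g (g₁ x) x) (hg₂ : ∀ x, HasDerivAt g₁ (g₂ x) x)
    (hg₃ : ∀ x, HasDerivAt g₂ (g₃ x) x) (hK₀ : ∀ x, |g x| ≤ K) (hK₁ : ∀ x, |g₁ x| ≤ K)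
    (hK₂ : ∀ x, |g₂ x| ≤ K) (hK₃ : ∀ x, |g₃ x| ≤ K) {N : ℝ} (hN : 1 ≤ N) (y : Fin p → ℝ) :
    |∫ z, rowFun g N s m β ℓ (y + z) ∂μ - ∫ z, rowFun g N s m β ℓ (y + z) ∂ν|
      ≤ 140 * 2 ^ b * (K * max 1 (β ^ 2) * D * H / N) *
        ((L * v) ^ 3 * (1 + wavg s m (fun w => |y ⬝ᵥ w| ^ b)) + (L * v) ^ (b + 3)) := by
  obtain ⟨A, B, γ, e, c, hT⟩ := exists_taylor_row hs hm hβ hQ hD hℓ hg₁ hg₂ hg₃ hK₁ hK₂ hK₃ hN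
    (fun w => y ⬝ᵥ w)
  set Y := wavg s m (fun w => |y ⬝ᵥ w| ^ b) with hY
  have hm0 : ∀ w ∈ s, 0 ≤ m w := fun w hw => (hm w hw).le
  have hY0 : 0 ≤ Y := wavg_nonneg hm0 fun w _ => by positivity
  have hK : 0 ≤ K := (abs_nonneg _).trans (hK₁ 0)
  have hN0 : 0 < N := by linarith
  set c₀ := 70 * 2 ^ b * (K * max 1 (β ^ 2) * D * H / N) with hc₀
  have hc₀0 : 0 ≤ c₀ := by positivity
  -- By linearity the Gibbs mean of `z ⬝ᵥ w` is the pairing of `z` with one fixed vector, so only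
  -- the mean and second moments of projections of `z` enter.
  set P : (Fin p → ℝ) → ℝ := fun z => A + B * (z ⬝ᵥ ∑ w ∈ s, e w • w)
    + (∑ w ∈ s, c w * (z ⬝ᵥ w) ^ 2 + γ * (z ⬝ᵥ ∑ w ∈ s, e w • w) ^ 2) with hP
  set R : (Fin p → ℝ) → ℝ := fun z => c₀ * (L ^ 3 * (1 + Y) * (∑ j, |z j|) ^ 3
    + L ^ (b + 3) * (∑ j, |z j|) ^ (b + 3)) with hR
  have hdot : ∀ z : Fin p → ℝ, ∑ w ∈ s, e w * (z ⬝ᵥ w) = z ⬝ᵥ ∑ w ∈ s, e w • w := fun z => by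
    rw [dotProduct_sum]; simp [dotProduct_smul]
  have hpt : ∀ z, |rowFun g N s m β ℓ (y + z) - P z| ≤ R z := by
    intro z
    have := hT (fun w => z ⬝ᵥ w) (L * ∑ j, |z j|)
      (2 ^ b * H * (1 + Y + (L * ∑ j, |z j|) ^ b)) (fun w hws => abs_dotProduct_le_l1 (hw w hws) z)
      ?_
    · simp only [hdot, ← add_dotProduct] at this
      refine this.trans (le_of_eq ?_)
      simp only [hR, hc₀, pow_add, mul_pow]
      ring
    · intro t ht
      have hb : ∀ w ∈ s, max 1 (ℓ (y ⬝ᵥ w + t * z ⬝ᵥ w)) ^ Q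
          ≤ 2 ^ b * H * ((1 + (L * ∑ j, |z j|) ^ b) + |y ⬝ᵥ w| ^ b) := by
        intro w hws
        refine (hℓH _).trans ?_
        have h1 : |y ⬝ᵥ w + t * z ⬝ᵥ w| ≤ |y ⬝ᵥ w| + L * ∑ j, |z j| := by
          refine (abs_add_le _ _).trans (add_le_add_right ?_ _)
          rw [abs_mul, abs_of_nonneg ht.1]
          exact (mul_le_of_le_one_left (abs_nonneg _) ht.2).trans
            (abs_dotProduct_le_l1 (hw w hws) z)
        have hV : 0 ≤ L * ∑ j, |z j| := mul_nonneg hL (Finset.sum_nonneg fun j _ => abs_nonneg _)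
        have h2 : |y ⬝ᵥ w + t * z ⬝ᵥ w| ^ b ≤ 2 ^ b * (|y ⬝ᵥ w| ^ b + (L * ∑ j, |z j|) ^ b) := by
          refine (pow_le_pow_left₀ (abs_nonneg _) h1 b).trans ?_
          refine (add_pow_le (abs_nonneg _) hV b).trans ?_
          exact mul_le_mul_of_nonneg_right (pow_le_pow_right₀ one_le_two (Nat.sub_le _ _))
            (by positivity)
        have h3 : (1 : ℝ) ≤ 2 ^ b := one_le_pow₀ one_le_two
        calc H * (1 + |y ⬝ᵥ w + t * z ⬝ᵥ w| ^ b)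
            ≤ H * (2 ^ b + 2 ^ b * (|y ⬝ᵥ w| ^ b + (L * ∑ j, |z j|) ^ b)) := by gcongr
          _ = _ := by ring
      refine (wavg_mono hm0 hb).trans (le_of_eq ?_)
      rw [wavg_const_mul, wavg_add, wavg_const hs hm, hY]
      ring
  have hfc : Continuous fun z => rowFun g N s m β ℓ (y + z) :=
    (continuous_rowFun (continuous_iff_continuousAt.2 fun x => (hg₁ x).continuousAt) N hs hm β
      (continuous_iff_continuousAt.2 fun x => (hℓ.deriv₁ x).continuousAt)).comp
      (continuous_const.add continuous_id)
  have hfb : ∀ z, |rowFun g N s m β ℓ (y + z)| ≤ K := fun z => hK₀ _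
  have hlin : ∀ {κ : Measure (Fin p → ℝ)} [IsProbabilityMeasure κ], IsBlockLaw κ (b + 3) v →
      ∀ w, Integrable (fun z => z ⬝ᵥ w) κ := fun hκ w => by
    simpa using integrable_pow_of_memLp (memLp_dotProduct hκ.memLp w) (k := 1) (by omega)
  have hsq : ∀ {κ : Measure (Fin p → ℝ)} [IsProbabilityMeasure κ], IsBlockLaw κ (b + 3) v →
      ∀ w, Integrable (fun z => (z ⬝ᵥ w) ^ 2) κ := fun hκ w =>
    integrable_pow_of_memLp (memLp_dotProduct hκ.memLp w) (by omega)
  have hPint : ∀ {κ : Measure (Fin p → ℝ)} [IsProbabilityMeasure κ], IsBlockLaw κ (b + 3) v →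
      Integrable P κ := fun hκ =>
    ((integrable_const A).add ((hlin hκ _).const_mul B)).add
      ((integrable_finsetSum _ fun w _ => (hsq hκ w).const_mul (c w)).add
        ((hsq hκ _).const_mul γ))
  have hPeq : ∀ {κ : Measure (Fin p → ℝ)} [IsProbabilityMeasure κ], IsBlockLaw κ (b + 3) v →
      ∫ z, P z ∂κ = A + (∑ w ∈ s, c w * ∫ z, (z ⬝ᵥ w) ^ 2 ∂κ
        + γ * ∫ z, (z ⬝ᵥ ∑ w ∈ s, e w • w) ^ 2 ∂κ) := by
    intro κ _ hκ
    simp only [hP]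
    have i1 : Integrable (fun z => B * (z ⬝ᵥ ∑ w ∈ s, e w • w)) κ := (hlin hκ _).const_mul B
    have i2 : Integrable (fun z => A + B * (z ⬝ᵥ ∑ w ∈ s, e w • w)) κ := (integrable_const A).add i1
    have i3 : ∀ w ∈ s, Integrable (fun z => c w * (z ⬝ᵥ w) ^ 2) κ := fun w _ =>
      (hsq hκ w).const_mul (c w)
    have i4 : Integrable (fun z => γ * (z ⬝ᵥ ∑ w ∈ s, e w • w) ^ 2) κ := (hsq hκ _).const_mul γ
    have i5 : Integrable (fun z => ∑ w ∈ s, c w * (z ⬝ᵥ w) ^ 2) κ := integrable_finsetSum _ i3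
    have i6 : Integrable (fun z => ∑ w ∈ s, c w * (z ⬝ᵥ w) ^ 2
      + γ * (z ⬝ᵥ ∑ w ∈ s, e w • w) ^ 2) κ := i5.add i4
    rw [integral_add i2 i6, integral_add (integrable_const A) i1, integral_add i5 i4,
      integral_finsetSum _ i3, integral_const_mul,
      integral_const_mul, hκ.mean]
    simp [integral_const_mul]
  have hl : ∀ {κ : Measure (Fin p → ℝ)} [IsProbabilityMeasure κ], IsBlockLaw κ (b + 3) v →
      ∀ k ≤ b + 3, Integrable (fun z : Fin p → ℝ => (∑ j, |z j|) ^ k) κ := fun hκ k hk =>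
    integrable_pow_of_memLp (memLp_l1 hκ.memLp) hk
  have hRint : ∀ {κ : Measure (Fin p → ℝ)} [IsProbabilityMeasure κ], IsBlockLaw κ (b + 3) v →
      Integrable R κ := fun hκ =>
    (((hl hκ 3 (by omega)).const_mul _).add ((hl hκ _ le_rfl).const_mul _)).const_mul _
  have hRle : ∀ {κ : Measure (Fin p → ℝ)} [IsProbabilityMeasure κ], IsBlockLaw κ (b + 3) v →
      ∫ z, R z ∂κ ≤ c₀ * ((L * v) ^ 3 * (1 + Y) + (L * v) ^ (b + 3)) := by
    intro κ _ hκ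
    simp only [hR]
    rw [integral_const_mul, integral_add ((hl hκ 3 (by omega)).const_mul _)
      ((hl hκ _ le_rfl).const_mul _), integral_const_mul, integral_const_mul]
    refine mul_le_mul_of_nonneg_left ?_ hc₀0
    calc _ ≤ L ^ 3 * (1 + Y) * v ^ 3 + L ^ (b + 3) * v ^ (b + 3) :=
          add_le_add (mul_le_mul_of_nonneg_left (hκ.moment 3 (by omega)) (by positivity))
            (mul_le_mul_of_nonneg_left (hκ.moment _ le_rfl) (by positivity))
      _ = _ := by rw [mul_pow, mul_pow]; ring
  refine (abs_integral_sub_le_of_approx (integrable_of_continuous_of_bounded hfc hfb)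
    (integrable_of_continuous_of_bounded hfc hfb) (hPint hμ) (hPint hν) (hRint hμ) (hRint hν)
    ?_ hpt).trans ((add_le_add (hRle hμ) (hRle hν)).trans (le_of_eq ?_))
  · rw [hPeq hμ, hPeq hν]; simp only [hcov]
  · rw [hc₀]; ring

end

/-! ### Even moments of sums of independent centred random variables -/

/-- In the binomial expansion, every term of degree at least two in `x` is at most its coefficient
times `(|s| ^ k + |x| ^ k) * x ^ 2`. The linear term is kept exactly, because it vanishes in
expectation when `x` is centred and independent of `s`. -/
theorem add_pow_le_second_order (s x : ℝ) (k : ℕ) :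
    (s + x) ^ (k + 2) ≤ s ^ (k + 2) + (k + 2) * (s ^ (k + 1) * x)
      + 2 ^ (k + 2) * (|s| ^ k * x ^ 2 + |x| ^ (k + 2)) := by
  have hX : ∀ i ∈ Finset.range (k + 1), x ^ (i + 1 + 1) * s ^ (k + 2 - (i + 1 + 1)) *
      ((k + 2).choose (i + 1 + 1) : ℝ)
      ≤ (|s| ^ k * x ^ 2 + |x| ^ (k + 2)) * ((k + 2).choose (i + 1 + 1) : ℝ) := by
    intro i hi
    have hik : i ≤ k := Nat.lt_succ_iff.1 (Finset.mem_range.1 hi)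
    refine mul_le_mul_of_nonneg_right ?_ (Nat.cast_nonneg _)
    have e : k + 2 - (i + 1 + 1) = k - i := by omega
    rw [e]
    refine (le_abs_self _).trans ?_
    rw [abs_mul, abs_pow, abs_pow]
    have hmax : |x| ^ i * |s| ^ (k - i) ≤ |s| ^ k + |x| ^ k := by
      rcases le_total |x| |s| with h | h
      · calc |x| ^ i * |s| ^ (k - i) ≤ |s| ^ i * |s| ^ (k - i) := by gcongr
          _ = |s| ^ k := by rw [← pow_add, Nat.add_sub_cancel' hik]
          _ ≤ _ := le_add_of_nonneg_right (by positivity)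
      · calc |x| ^ i * |s| ^ (k - i) ≤ |x| ^ i * |x| ^ (k - i) := by gcongr
          _ = |x| ^ k := by rw [← pow_add, Nat.add_sub_cancel' hik]
          _ ≤ _ := le_add_of_nonneg_left (by positivity)
    calc |x| ^ (i + 1 + 1) * |s| ^ (k - i) = (|x| ^ i * |s| ^ (k - i)) * |x| ^ 2 := by ring
      _ ≤ (|s| ^ k + |x| ^ k) * |x| ^ 2 := by gcongr
      _ = _ := by rw [← sq_abs x]; ring
  have hsum : ∑ i ∈ Finset.range (k + 1), ((k + 2).choose (i + 1 + 1) : ℝ) ≤ 2 ^ (k + 2) := by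
    have h := Nat.sum_range_choose (k + 2)
    rw [Finset.sum_range_succ', Finset.sum_range_succ'] at h
    have h' : ∑ i ∈ Finset.range (k + 1), (k + 2).choose (i + 1 + 1) ≤ 2 ^ (k + 2) := by omega
    exact_mod_cast h'
  rw [add_comm s x, add_pow, Finset.sum_range_succ', Finset.sum_range_succ']
  have h3 := Finset.sum_le_sum hX
  rw [← Finset.mul_sum] at h3
  have h4 := mul_le_mul_of_nonneg_left hsum
    (by positivity : 0 ≤ |s| ^ k * x ^ 2 + |x| ^ (k + 2))
  have e1 : k + 2 - (0 + 1) = k + 1 := by omega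
  have e2 : ∀ i, k + 2 - (i + 1 + 1) = k - i := fun i => by omega
  simp only [e2] at h3
  simp only [e1, e2, zero_add, pow_one, pow_zero, Nat.sub_zero, Nat.choose_zero_right,
    Nat.choose_one_right, Nat.cast_one, one_mul, mul_one]
  push_cast
  linarith

section moments

variable {Ω ι : Type*} [MeasurableSpace Ω] {P : Measure Ω} [IsProbabilityMeasure P]
  {ξ : ι → Ω → ℝ}

/-- The variables are added one by one. The bound `B` has to hold for all partial sums, since each
of them serves as the `s` of the second order expansion. -/
theorem integral_sum_pow_le (hind : iIndepFun ξ P) (hmeas : ∀ a, Measurable (ξ a)) {j : ℕ}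
    (hL : ∀ a, MemLp (ξ a) ((2 * j + 2 : ℕ) : ℝ≥0∞) P) (hmean : ∀ a, ∫ ω, ξ a ω ∂P = 0) {B : ℝ}
    (hB : ∀ T : Finset ι, ∫ ω, (∑ a ∈ T, ξ a ω) ^ (2 * j) ∂P ≤ B) (T : Finset ι) :
    ∫ ω, (∑ a ∈ T, ξ a ω) ^ (2 * j + 2) ∂P ≤ 2 ^ (2 * j + 2) *
      (B * ∑ a ∈ T, ∫ ω, ξ a ω ^ 2 ∂P + ∑ a ∈ T, ∫ ω, ξ a ω ^ (2 * j + 2) ∂P) := by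
  classical
  induction T using Finset.induction_on with
  | empty => simp
  | insert a T ha ih =>
    have hev : Even (2 * j + 2) := ⟨j + 1, by ring⟩
    set S : Ω → ℝ := fun ω => ∑ a ∈ T, ξ a ω with hS
    have hSL : MemLp S ((2 * j + 2 : ℕ) : ℝ≥0∞) P := memLp_finsetSum T fun a _ => hL a
    have hSm : Measurable S := Finset.measurable_sum T fun a _ => hmeas a
    have hSa : IndepFun S (ξ a) P := by
      have := hind.indepFun_finsetSum_of_notMem hmeas ha
      convert this using 1
      funext ω; simp [hS]
    have hi : ∀ k l : ℕ, IndepFun (fun ω => S ω ^ k) (fun ω => ξ a ω ^ l) P := fun k l =>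
      hSa.comp (φ := fun x => x ^ k) (ψ := fun x => x ^ l) (by fun_prop) (by fun_prop)
    have hSi : ∀ k ≤ 2 * j + 2, Integrable (fun ω => S ω ^ k) P := fun k hk =>
      integrable_pow_of_memLp hSL hk
    have hξi : ∀ k ≤ 2 * j + 2, Integrable (fun ω => ξ a ω ^ k) P := fun k hk =>
      integrable_pow_of_memLp (hL a) hk
    have i1 : Integrable (fun ω => S ω ^ (2 * j + 1) * ξ a ω) P := by
      have := (hi (2 * j + 1) 1).integrable_mul (hSi _ (by omega)) (hξi 1 (by omega))
      simp only [pow_one] at this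
      exact this
    have i2 : Integrable (fun ω => S ω ^ (2 * j) * ξ a ω ^ 2) P :=
      (hi (2 * j) 2).integrable_mul (hSi _ (by omega)) (hξi 2 (by omega))
    have v1 : ∫ ω, S ω ^ (2 * j + 1) * ξ a ω ∂P = 0 := by
      have := (hi (2 * j + 1) 1).integral_fun_mul_eq_mul_integral
        (hSi _ (by omega)).aestronglyMeasurable (hξi 1 (by omega)).aestronglyMeasurable
      simpa [hmean] using this
    have v2 : ∫ ω, S ω ^ (2 * j) * ξ a ω ^ 2 ∂P ≤ B * ∫ ω, ξ a ω ^ 2 ∂P := by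
      rw [(hi (2 * j) 2).integral_fun_mul_eq_mul_integral
        (hSi _ (by omega)).aestronglyMeasurable (hξi 2 (by omega)).aestronglyMeasurable]
      exact mul_le_mul_of_nonneg_right (hB T) (integral_nonneg fun ω => sq_nonneg _)
    have hle : ∫ ω, (S ω + ξ a ω) ^ (2 * j + 2) ∂P ≤
        ∫ ω, (S ω ^ (2 * j + 2) + ((2 * j : ℕ) + 2) * (S ω ^ (2 * j + 1) * ξ a ω)
          + 2 ^ (2 * j + 2) * (S ω ^ (2 * j) * ξ a ω ^ 2 + ξ a ω ^ (2 * j + 2))) ∂P := by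
      refine integral_mono (integrable_pow_of_memLp (hSL.add (hL a)) le_rfl) ?_ fun ω => ?_
      · exact ((hSi _ le_rfl).add (i1.const_mul _)).add ((i2.add (hξi _ le_rfl)).const_mul _)
      · have := add_pow_le_second_order (S ω) (ξ a ω) (2 * j)
        rwa [(even_two_mul j).pow_abs, hev.pow_abs] at this
    have j1 : Integrable (fun ω => ((2 * j : ℕ) + 2 : ℝ) * (S ω ^ (2 * j + 1) * ξ a ω)) P :=
      i1.const_mul _
    have j2 : Integrable (fun ω => S ω ^ (2 * j) * ξ a ω ^ 2 + ξ a ω ^ (2 * j + 2)) P :=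
      i2.add (hξi _ le_rfl)
    have j3 : Integrable (fun ω => (2 : ℝ) ^ (2 * j + 2) *
      (S ω ^ (2 * j) * ξ a ω ^ 2 + ξ a ω ^ (2 * j + 2))) P := j2.const_mul _
    have j4 : Integrable (fun ω => S ω ^ (2 * j + 2) +
      ((2 * j : ℕ) + 2 : ℝ) * (S ω ^ (2 * j + 1) * ξ a ω)) P := (hSi _ le_rfl).add j1
    rw [integral_add j4 j3, integral_add (hSi _ le_rfl) j1, integral_const_mul,
      integral_const_mul, v1, integral_add i2 (hξi _ le_rfl)] at hle
    have e : ∀ ω, ∑ a ∈ insert a T, ξ a ω = S ω + ξ a ω := fun ω => by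
      rw [Finset.sum_insert ha, add_comm]
    simp only [e, Finset.sum_insert ha]
    have hp : (0 : ℝ) ≤ 2 ^ (2 * j + 2) := by positivity
    nlinarith [mul_le_mul_of_nonneg_left v2 hp]

/-- Induction on the order `2 j`, for all subsets `T` at once. The second moment has its own
hypothesis because it is bounded by the covariance, with no loss in the block size, whereas higher
moments may lose a factor `Δ j`. -/
theorem integral_sum_even_pow_le [Fintype ι] (hind : iIndepFun ξ P)
    (hmeas : ∀ a, Measurable (ξ a)) {m : ℕ} (hL : ∀ a, MemLp (ξ a) ((2 * m : ℕ) : ℝ≥0∞) P)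
    (hmean : ∀ a, ∫ ω, ξ a ω ∂P = 0) {W : ℝ} (hW : 0 ≤ W) {Δ : ℕ → ℝ} (hΔ : Monotone Δ)
    (hΔ1 : ∀ j, 1 ≤ Δ j) (h2 : 1 ≤ m → ∑ a, ∫ ω, ξ a ω ^ 2 ∂P ≤ W)
    (h : ∀ j, 2 ≤ j → j ≤ m → ∑ a, ∫ ω, ξ a ω ^ (2 * j) ∂P ≤ W ^ j * Δ j) (T : Finset ι) :
    ∫ ω, (∑ a ∈ T, ξ a ω) ^ (2 * m) ∂P ≤ 8 ^ (m * m) * W ^ m * Δ m := by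
  suffices H : ∀ j ≤ m, ∀ T : Finset ι,
      ∫ ω, (∑ a ∈ T, ξ a ω) ^ (2 * j) ∂P ≤ 8 ^ (j * j) * W ^ j * Δ j from H m le_rfl T
  intro j
  induction j with
  | zero => intro _ T; simpa using hΔ1 0
  | succ j ih =>
    intro hj T
    have hev : Even (2 * j + 2) := ⟨j + 1, by ring⟩
    have hΔ0 : ∀ j, 0 ≤ Δ j := fun j => zero_le_one.trans (hΔ1 j)
    have step := integral_sum_pow_le hind hmeas (j := j)
      (fun a => (hL a).mono_exponent (by exact_mod_cast (by omega : 2 * j + 2 ≤ 2 * m))) hmean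
      (ih (by omega)) T
    have hsub : ∀ {f : ι → ℝ}, (∀ a, 0 ≤ f a) → ∑ a ∈ T, f a ≤ ∑ a, f a := fun hf =>
      Finset.sum_le_sum_of_subset_of_nonneg (Finset.subset_univ _) fun a _ _ => hf a
    have k2 : ∑ a ∈ T, ∫ ω, ξ a ω ^ 2 ∂P ≤ W :=
      (hsub fun a => integral_nonneg fun ω => sq_nonneg _).trans (h2 (by omega))
    have kj : ∑ a ∈ T, ∫ ω, ξ a ω ^ (2 * j + 2) ∂P ≤ W ^ (j + 1) * Δ (j + 1) := by
      refine (hsub fun a => integral_nonneg fun ω => ?_).trans ?_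
      · exact hev.pow_nonneg _
      · rcases Nat.eq_zero_or_pos j with rfl | hj0
        · simpa using (h2 (by omega)).trans (le_mul_of_one_le_right hW (hΔ1 _))
        · exact h (j + 1) (by omega) hj
    have e1 : (1 : ℝ) ≤ 8 ^ (j * j) := one_le_pow₀ (by norm_num)
    -- The constant `8 ^ (j * j)` is chosen to absorb the factor `2 ^ (2 * j + 3)` lost at each
    -- step.
    have e2 : (2 : ℝ) ^ (2 * j + 2) * 2 * 8 ^ (j * j) ≤ 8 ^ ((j + 1) * (j + 1)) := by
      have : (8 : ℝ) ^ ((j + 1) * (j + 1)) = 8 ^ (j * j) * 8 ^ j * 8 ^ j * 8 := by ring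
      rw [this]
      have e3 : (2 : ℝ) ^ (2 * j + 2) ≤ 4 * (8 ^ j * 8 ^ j) := by
        have : (2 : ℝ) ^ (2 * j + 2) = 4 * (2 ^ j * 2 ^ j) := by ring
        rw [this]; gcongr <;> norm_num
      nlinarith
    calc ∫ ω, (∑ a ∈ T, ξ a ω) ^ (2 * (j + 1)) ∂P
        ≤ 2 ^ (2 * j + 2) * ((8 ^ (j * j) * W ^ j * Δ j) * W + W ^ (j + 1) * Δ (j + 1)) := by
          refine step.trans (mul_le_mul_of_nonneg_left (add_le_add ?_ kj) (by positivity))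
          exact mul_le_mul_of_nonneg_left k2
            (mul_nonneg (by positivity) (hΔ0 j))
      _ ≤ 2 ^ (2 * j + 2) * (8 ^ (j * j) * (W ^ (j + 1) * Δ (j + 1))
            + 8 ^ (j * j) * (W ^ (j + 1) * Δ (j + 1))) := by
          have hp : 0 ≤ W ^ (j + 1) * Δ (j + 1) := mul_nonneg (by positivity) (hΔ0 _)
          refine mul_le_mul_of_nonneg_left (add_le_add ?_ (le_mul_of_one_le_left hp e1))
            (by positivity)
          have := mul_le_mul_of_nonneg_left (hΔ (Nat.le_succ j))
            (by positivity : 0 ≤ 8 ^ (j * j) * W ^ (j + 1))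
          calc _ = 8 ^ (j * j) * W ^ (j + 1) * Δ j := by ring
            _ ≤ _ := this
            _ = _ := by simp [mul_assoc]
      _ = (2 ^ (2 * j + 2) * 2 * 8 ^ (j * j)) * (W ^ (j + 1) * Δ (j + 1)) := by ring
      _ ≤ 8 ^ ((j + 1) * (j + 1)) * (W ^ (j + 1) * Δ (j + 1)) :=
          mul_le_mul_of_nonneg_right e2 (mul_nonneg (by positivity) (hΔ0 _))
      _ = _ := by ring

end moments

/-! ### Lindeberg replacement for product measures -/

/-- Telescoping along hybrids whose coordinates come from `μ` or `ν`. It is applied to families of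
measures twice: to the rows of the design and to the blocks of one row. -/
theorem abs_sub_le_sum_of_swap {ι α : Type*} [Fintype ι] [DecidableEq ι] (Φ : (ι → α) → ℝ)
    (μ ν : ι → α) (ε : ι → ℝ)
    (h : ∀ κ : ι → α, (∀ a, κ a = μ a ∨ κ a = ν a) → ∀ a,
      |Φ (Function.update κ a (μ a)) - Φ (Function.update κ a (ν a))| ≤ ε a) :
    |Φ μ - Φ ν| ≤ ∑ a, ε a := by
  suffices H : ∀ T : Finset ι, |Φ μ - Φ (T.piecewise ν μ)| ≤ ∑ a ∈ T, ε a by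
    simpa using H Finset.univ
  intro T
  induction T using Finset.induction_on with
  | empty => simp
  | insert a T ha ih =>
    have hκ : ∀ b, T.piecewise ν μ b = μ b ∨ T.piecewise ν μ b = ν b := fun b => by
      by_cases hb : b ∈ T <;> simp [hb]
    have e1 : Function.update (T.piecewise ν μ) a (μ a) = T.piecewise ν μ := by
      rw [Function.update_eq_self_iff]; simp [ha]
    have e2 : Function.update (T.piecewise ν μ) a (ν a) = (insert a T).piecewise ν μ :=
      (Finset.piecewise_insert T ν μ a).symm
    have := h _ hκ a
    rw [e1, e2] at this
    rw [Finset.sum_insert ha, add_comm]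
    exact (abs_sub_le _ _ _).trans (add_le_add ih this)

section pi

variable {ι : Type*} [Fintype ι] [DecidableEq ι] {E : Type*} [MeasurableSpace E]

/-- Overwriting coordinate `a` by an independent sample. With Fubini this lets one coordinate be
integrated while the others are frozen. -/
theorem map_update_prod_eq_pi (κ : ι → Measure E) [∀ a, IsProbabilityMeasure (κ a)]
    (lam : Measure E) [IsProbabilityMeasure lam] (a : ι) :
    ((Measure.pi κ).prod lam).map (fun x : (ι → E) × E => Function.update x.1 a x.2)
      = Measure.pi (Function.update κ a lam) := by
  have : ∀ b, IsProbabilityMeasure (Function.update κ a lam b) := fun b => by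
    rcases eq_or_ne b a with rfl | hb
    · simpa
    · simpa [hb] using inferInstanceAs (IsProbabilityMeasure (κ b))
  refine (Measure.pi_eq fun s hs => ?_).symm
  rw [Measure.map_apply measurable_update' (MeasurableSet.univ_pi hs)]
  have e : (fun x : (ι → E) × E => Function.update x.1 a x.2) ⁻¹' Set.univ.pi s
      = (Set.univ.pi (Function.update s a Set.univ)) ×ˢ s a := by
    ext ⟨x, z⟩
    simp only [Set.mem_preimage, Set.mem_pi, Set.mem_univ, true_implies, Set.mem_prod]
    constructor
    · intro h
      refine ⟨fun b => ?_, by simpa using h a⟩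
      rcases eq_or_ne b a with rfl | hb
      · simp
      · simpa [hb] using h b
    · rintro ⟨h, hz⟩ b
      rcases eq_or_ne b a with rfl | hb
      · simpa
      · simpa [hb] using h b
  rw [e, Measure.prod_prod, Measure.pi_pi, ← Finset.mul_prod_erase _ _ (Finset.mem_univ a),
    ← Finset.mul_prod_erase _ (fun b => Function.update κ a lam b (s b)) (Finset.mem_univ a)]
  simp only [Function.update_self, measure_univ, one_mul]
  rw [mul_comm]
  congr 1
  refine Finset.prod_congr rfl fun b hb => ?_
  rw [Function.update_of_ne (Finset.ne_of_mem_erase hb),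
    Function.update_of_ne (Finset.ne_of_mem_erase hb)]

theorem integral_pi_update (κ : ι → Measure E) [∀ a, IsProbabilityMeasure (κ a)]
    (lam : Measure E) [IsProbabilityMeasure lam] (a : ι) {f : (ι → E) → ℝ} (hf : Measurable f)
    {K : ℝ} (hK : ∀ x, |f x| ≤ K) :
    Integrable (fun x => ∫ z, f (Function.update x a z) ∂lam) (Measure.pi κ) ∧
    ∫ x, f x ∂Measure.pi (Function.update κ a lam)
      = ∫ x, ∫ z, f (Function.update x a z) ∂lam ∂Measure.pi κ := by
  have hm : Measurable fun x : (ι → E) × E => f (Function.update x.1 a x.2) :=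
    hf.comp measurable_update'
  have hi : Integrable (fun x : (ι → E) × E => f (Function.update x.1 a x.2))
      ((Measure.pi κ).prod lam) :=
    .of_bound hm.aestronglyMeasurable K (Filter.Eventually.of_forall fun _ => hK _)
  refine ⟨hi.integral_prod_left, ?_⟩
  rw [← map_update_prod_eq_pi, integral_map measurable_update'.aemeasurable
    hf.aestronglyMeasurable, integral_prod _ hi]

theorem abs_integral_pi_update_sub_le (κ : ι → Measure E) [∀ a, IsProbabilityMeasure (κ a)]
    (lam lam' : Measure E) [IsProbabilityMeasure lam] [IsProbabilityMeasure lam'] (a : ι)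
    {f : (ι → E) → ℝ} (hf : Measurable f) {K : ℝ} (hK : ∀ x, |f x| ≤ K) {R : (ι → E) → ℝ}
    (hR : Integrable R (Measure.pi κ))
    (h : ∀ x, |∫ z, f (Function.update x a z) ∂lam - ∫ z, f (Function.update x a z) ∂lam'|
      ≤ R x) :
    |∫ x, f x ∂Measure.pi (Function.update κ a lam)
      - ∫ x, f x ∂Measure.pi (Function.update κ a lam')| ≤ ∫ x, R x ∂Measure.pi κ := by
  obtain ⟨i1, e1⟩ := integral_pi_update κ lam a hf hK
  obtain ⟨i2, e2⟩ := integral_pi_update κ lam' a hf hK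
  rw [e1, e2, ← integral_sub i1 i2]
  exact abs_integral_le_integral_abs.trans (integral_mono (i1.sub i2).abs hR h)

end pi

/-! ### Replacing one row block by block -/

section

variable {p : ℕ} {ι : Type*} [Fintype ι] [DecidableEq ι]

-- The projections of the blocks on `w` are independent and centred. Their higher even moments are
-- bounded crudely through the `ℓ¹`-norm; the variance bound `h2` is supplied separately.
omit [DecidableEq ι] in
theorem integral_dotProduct_sum_pow_le {κ : ι → Measure (Fin p → ℝ)}
    [∀ a, IsProbabilityMeasure (κ a)] {m : ℕ} {v : ι → ℝ}
    (hκ : ∀ a, IsBlockLaw (κ a) (2 * m + 3) (v a)) {L : ℝ} (hL : 0 ≤ L) {W : ℝ} (hW : 0 ≤ W)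
    {Δ : ℕ → ℝ} (hΔ : Monotone Δ) (hΔ1 : ∀ j, 1 ≤ Δ j)
    (hv : ∀ j, 2 ≤ j → j ≤ m → ∑ a, (L * v a) ^ (2 * j) ≤ W ^ j * Δ j)
    {w : Fin p → ℝ} (hw : ∀ j, w j ∈ Set.Icc (-L) L)
    (h2 : ∑ a, ∫ z, (z ⬝ᵥ w) ^ 2 ∂κ a ≤ W) (T : Finset ι) :
    Integrable (fun x : ι → Fin p → ℝ => |(∑ a ∈ T, x a) ⬝ᵥ w| ^ (2 * m)) (Measure.pi κ) ∧
    ∫ x : ι → Fin p → ℝ, |(∑ a ∈ T, x a) ⬝ᵥ w| ^ (2 * m) ∂Measure.pi κ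
      ≤ 8 ^ (m * m) * W ^ m * Δ m := by
  set ξ : ι → (ι → Fin p → ℝ) → ℝ := fun a x => x a ⬝ᵥ w with hξ
  have hdm : Measurable fun z : Fin p → ℝ => z ⬝ᵥ w := by unfold dotProduct; fun_prop
  have hind : iIndepFun ξ (Measure.pi κ) := iIndepFun_pi fun a => hdm.aemeasurable
  have hmeas : ∀ a, Measurable (ξ a) := fun a => hdm.comp (measurable_pi_apply a)
  have hmp : ∀ a, MeasurePreserving (Function.eval a) (Measure.pi κ) (κ a) :=
    fun a => measurePreserving_eval κ a
  have hLp : ∀ a, MemLp (ξ a) ((2 * m + 3 : ℕ) : ℝ≥0∞) (Measure.pi κ) := fun a =>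
    (memLp_dotProduct (hκ a).memLp w).comp_measurePreserving (hmp a)
  have hint : ∀ (a : ι) (k : ℕ), ∫ x, ξ a x ^ k ∂Measure.pi κ = ∫ z, (z ⬝ᵥ w) ^ k ∂κ a := by
    intro a k
    rw [← (hmp a).map_eq, integral_map (hmp a).measurable.aemeasurable
      (hdm.pow_const k).aestronglyMeasurable]
  have hmean : ∀ a, ∫ x, ξ a x ∂Measure.pi κ = 0 := fun a => by
    have := hint a 1
    simpa [(hκ a).mean w] using this
  have hLp' : ∀ a, MemLp (ξ a) ((2 * m : ℕ) : ℝ≥0∞) (Measure.pi κ) := fun a =>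
    (hLp a).mono_exponent (by exact_mod_cast (by omega : 2 * m ≤ 2 * m + 3))
  have e : ∀ x : ι → Fin p → ℝ, |(∑ a ∈ T, x a) ⬝ᵥ w| ^ (2 * m)
      = (∑ a ∈ T, ξ a x) ^ (2 * m) := fun x => by
    rw [(even_two_mul m).pow_abs, sum_dotProduct]
  simp only [e]
  refine ⟨integrable_pow_of_memLp (memLp_finsetSum T fun a _ => hLp' a) le_rfl,
    integral_sum_even_pow_le hind hmeas hLp' hmean hW hΔ hΔ1 (fun _ => ?_) (fun j h2j hj => ?_) T⟩
  · simpa only [hint] using h2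
  · refine (Finset.sum_le_sum fun a _ => ?_).trans (hv j h2j hj)
    rw [hint a]
    calc ∫ z, (z ⬝ᵥ w) ^ (2 * j) ∂κ a ≤ ∫ z, L ^ (2 * j) * (∑ i, |z i|) ^ (2 * j) ∂κ a := by
          refine integral_mono
            (integrable_pow_of_memLp (memLp_dotProduct (hκ a).memLp w) (by omega))
            ((integrable_pow_of_memLp (memLp_l1 (hκ a).memLp) (by omega)).const_mul _) fun z => ?_
          have := pow_le_pow_left₀ (abs_nonneg _) (abs_dotProduct_le_l1 hw z) (2 * j)
          rwa [(even_two_mul j).pow_abs, mul_pow] at this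
      _ ≤ L ^ (2 * j) * v a ^ (2 * j) := by
          rw [integral_const_mul]
          exact mul_le_mul_of_nonneg_left ((hκ a).moment _ (by omega)) (by positivity)
      _ = _ := (mul_pow _ _ _).symm

/-- When block `a` is swapped, `y` is the sum of the other blocks of a hybrid. The swap estimate is
averaged over `y`, and the moment bound holds uniformly over hybrids because they share second
moments and block bounds. -/
theorem abs_integral_pi_sum_sub_le {μ ν : ι → Measure (Fin p → ℝ)}
    [∀ a, IsProbabilityMeasure (μ a)] [∀ a, IsProbabilityMeasure (ν a)] {m : ℕ} {v : ι → ℝ}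
    (hv0 : ∀ a, 0 ≤ v a)
    (hμ : ∀ a, IsBlockLaw (μ a) (2 * m + 3) (v a)) (hν : ∀ a, IsBlockLaw (ν a) (2 * m + 3) (v a))
    (hcov : ∀ a (w : Fin p → ℝ), ∫ z, (z ⬝ᵥ w) ^ 2 ∂μ a = ∫ z, (z ⬝ᵥ w) ^ 2 ∂ν a)
    {L : ℝ} (hL : 0 ≤ L) {W : ℝ} (hW : 0 ≤ W)
    {Δ : ℕ → ℝ} (hΔ : Monotone Δ) (hΔ1 : ∀ j, 1 ≤ Δ j)
    (hv : ∀ j, 2 ≤ j → j ≤ m → ∑ a, (L * v a) ^ (2 * j) ≤ W ^ j * Δ j)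
    {s : Finset (Fin p → ℝ)} (hs : s.Nonempty) (hw : ∀ w ∈ s, ∀ j, w j ∈ Set.Icc (-L) L)
    (h2 : ∀ w ∈ s, ∑ a, ∫ z, (z ⬝ᵥ w) ^ 2 ∂μ a ≤ W)
    {c : (Fin p → ℝ) → ℝ} (hc : ∀ w ∈ s, 0 < c w) {h : (Fin p → ℝ) → ℝ} (hh : Continuous h)
    {K : ℝ} (hK : ∀ x, |h x| ≤ K) {C : ℝ} (hC : 0 ≤ C)
    (hswap : ∀ a y, |∫ z, h (y + z) ∂μ a - ∫ z, h (y + z) ∂ν a|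
      ≤ C * ((L * v a) ^ 3 * (1 + wavg s c (fun w => |y ⬝ᵥ w| ^ (2 * m)))
        + (L * v a) ^ (2 * m + 3))) :
    |∫ x : ι → Fin p → ℝ, h (∑ a, x a) ∂Measure.pi μ
      - ∫ x : ι → Fin p → ℝ, h (∑ a, x a) ∂Measure.pi ν|
      ≤ ∑ a, C * ((L * v a) ^ 3 * (1 + 8 ^ (m * m) * W ^ m * Δ m) + (L * v a) ^ (2 * m + 3)) := by
  refine abs_sub_le_sum_of_swap
    (fun κ : ι → Measure (Fin p → ℝ) => ∫ x : ι → Fin p → ℝ, h (∑ a, x a) ∂Measure.pi κ) μ ν _ ?_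
  intro κ hκ a
  have : ∀ a, IsProbabilityMeasure (κ a) := fun a => by
    rcases hκ a with e | e <;> rw [e] <;> infer_instance
  have hκl : ∀ a, IsBlockLaw (κ a) (2 * m + 3) (v a) := fun a => by
    rcases hκ a with e | e <;> rw [e]
    · exact hμ a
    · exact hν a
  have hκ2 : ∀ w ∈ s, ∑ a, ∫ z, (z ⬝ᵥ w) ^ 2 ∂κ a ≤ W := fun w hws => by
    refine le_trans (le_of_eq (Finset.sum_congr rfl fun a _ => ?_)) (h2 w hws)
    rcases hκ a with e | e <;> rw [e]
    exact (hcov a w).symm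
  set T := Finset.univ.erase a with hT
  have hmom := fun w hws =>
    integral_dotProduct_sum_pow_le hκl hL hW hΔ hΔ1 hv (hw w hws) (hκ2 w hws) T
  have hWint : Integrable
      (fun x : ι → Fin p → ℝ => wavg s c (fun w => |(∑ b ∈ T, x b) ⬝ᵥ w| ^ (2 * m)))
      (Measure.pi κ) :=
    (integrable_finsetSum _ fun w hws => (hmom w hws).1.const_mul (c w)).div_const _
  have hWle : ∫ x : ι → Fin p → ℝ, wavg s c (fun w => |(∑ b ∈ T, x b) ⬝ᵥ w| ^ (2 * m))
      ∂Measure.pi κ ≤ 8 ^ (m * m) * W ^ m * Δ m := by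
    -- The weights `c` do not depend on `x`, so the integral moves inside the weighted average and a
    -- bound for each single `w` is enough.
    have : ∫ x : ι → Fin p → ℝ, wavg s c (fun w => |(∑ b ∈ T, x b) ⬝ᵥ w| ^ (2 * m))
        ∂Measure.pi κ = wavg s c (fun w =>
          ∫ x : ι → Fin p → ℝ, |(∑ b ∈ T, x b) ⬝ᵥ w| ^ (2 * m) ∂Measure.pi κ) := by
      simp only [wavg]
      rw [integral_div, integral_finsetSum _ fun w hws => (hmom w hws).1.const_mul (c w)]
      simp only [integral_const_mul]
    rw [this]
    exact wavg_le_of_le hs hc fun w hws => (hmom w hws).2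
  have hsum : Continuous fun x : ι → Fin p → ℝ => ∑ a, x a := by fun_prop
  have hupd : ∀ (x : ι → Fin p → ℝ) z, ∑ b, Function.update x a z b = ∑ b ∈ T, x b + z := by
    intro x z
    rw [Finset.sum_update_of_mem (Finset.mem_univ a), add_comm, hT, Finset.sdiff_singleton_eq_erase]
  have i0 : Integrable (fun x : ι → Fin p → ℝ =>
      1 + wavg s c (fun w => |(∑ b ∈ T, x b) ⬝ᵥ w| ^ (2 * m))) (Measure.pi κ) :=
    (integrable_const 1).add hWint
  have i1 : Integrable (fun x : ι → Fin p → ℝ => (L * v a) ^ 3 *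
      (1 + wavg s c (fun w => |(∑ b ∈ T, x b) ⬝ᵥ w| ^ (2 * m)))) (Measure.pi κ) :=
    i0.const_mul _
  have i2 : Integrable (fun x : ι → Fin p → ℝ => (L * v a) ^ 3 *
      (1 + wavg s c (fun w => |(∑ b ∈ T, x b) ⬝ᵥ w| ^ (2 * m))) + (L * v a) ^ (2 * m + 3))
      (Measure.pi κ) := i1.add (integrable_const _)
  refine (abs_integral_pi_update_sub_le κ (μ a) (ν a) a (f := fun x => h (∑ a, x a))
    (hh.comp hsum).measurable (fun x => hK _) (i2.const_mul C) fun x => ?_).trans ?_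
  · simp only [hupd]
    exact hswap a _
  · rw [integral_const_mul]
    refine mul_le_mul_of_nonneg_left ?_ hC
    rw [integral_add i1 (integrable_const _), integral_const_mul,
      integral_add (integrable_const _) hWint]
    simp only [integral_const, probReal_univ, smul_eq_mul, one_mul]
    have := mul_nonneg hL (hv0 a)
    gcongr

end

/-! ### Laws of rows with independent blocks -/

theorem iIndepFun_map_iff {Ω E ι : Type*} [Fintype ι] [MeasurableSpace Ω] [MeasurableSpace E]
    {β : ι → Type*} [∀ a, MeasurableSpace (β a)] {P : Measure Ω} [IsProbabilityMeasure P]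
    {Z : Ω → E} (hZ : Measurable Z) {f : ∀ a, E → β a} (hf : ∀ a, Measurable (f a)) :
    iIndepFun f (P.map Z) ↔ iIndepFun (fun a ω => f a (Z ω)) P := by
  have : IsProbabilityMeasure (P.map Z) := Measure.isProbabilityMeasure_map hZ.aemeasurable
  rw [iIndepFun_iff_map_fun_eq_pi_map fun a => (hf a).aemeasurable,
    iIndepFun_iff_map_fun_eq_pi_map (f := fun a ω => f a (Z ω))
      fun a => ((hf a).comp hZ).aemeasurable,
    Measure.map_map (measurable_pi_lambda _ hf) hZ]
  have : ∀ a, (P.map Z).map (f a) = P.map fun ω => f a (Z ω) := fun a =>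
    Measure.map_map (hf a) hZ
  simp only [this]
  rfl

section

variable {p : ℕ} {ι : Type*} [DecidableEq ι]

/-- The restriction of a vector to the cell `a` of the partition into the fibres of `cell`. -/
def restr (cell : Fin p → ι) (a : ι) (x : Fin p → ℝ) : Fin p → ℝ :=
  fun l => if cell l = a then x l else 0

/-- The size of the cell `a`. -/
def cellCard (cell : Fin p → ι) (a : ι) : ℕ := (Finset.univ.filter fun l => cell l = a).card

/-- The subvectors indexed by the fibres of `cell` are independent under `lam`. -/
def IsBlockIndep (lam : Measure (Fin p → ℝ)) (cell : Fin p → ι) : Prop :=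
  iIndepFun (fun (a : ι) x => restr cell a x) lam

theorem measurable_restr (cell : Fin p → ι) (a : ι) : Measurable (restr cell a) :=
  measurable_pi_lambda _ fun l => by
    by_cases h : cell l = a
    · simpa [restr, h] using measurable_pi_apply l
    · simp [restr, h]

theorem restr_dotProduct (cell : Fin p → ι) (a : ι) (x w : Fin p → ℝ) :
    restr cell a x ⬝ᵥ w = x ⬝ᵥ restr cell a w := by
  simp only [dotProduct, restr]
  exact Finset.sum_congr rfl fun l _ => by split_ifs <;> simp

theorem sum_restr [Fintype ι] (cell : Fin p → ι) (x : Fin p → ℝ) : ∑ a, restr cell a x = x := by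
  funext l
  simp [restr]

theorem sum_cellCard [Fintype ι] (cell : Fin p → ι) : ∑ a, cellCard cell a = p := by
  simpa [cellCard] using (Finset.card_eq_sum_card_fiberwise (f := cell) (s := Finset.univ)
    (t := Finset.univ) (by simp)).symm

/-- A vector is the sum of its restrictions to the cells, and under block independence their joint
law is a product. -/
theorem IsBlockIndep.eq_map_sum [Fintype ι] {lam : Measure (Fin p → ℝ)} [IsProbabilityMeasure lam]
    {cell : Fin p → ι} (h : IsBlockIndep lam cell) :
    lam = (Measure.pi fun a => lam.map (restr cell a)).map fun x => ∑ a, x a := by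
  have hm : ∀ a, Measurable (restr cell a) := measurable_restr cell
  have := h.map_fun_eq_pi_map fun a => (hm a).aemeasurable
  rw [← this, Measure.map_map (by fun_prop) (measurable_pi_lambda _ hm)]
  have e : ((fun x : ι → Fin p → ℝ => ∑ a, x a) ∘ fun x a => restr cell a x) = id := by
    funext x; simp [sum_restr]
  rw [e, Measure.map_id]

/-- Centred rows with covariance matrix `S / n` whose coordinates have `k`-th absolute moment at
most `v ^ k` for `k ≤ r`. -/
structure IsRowLaw (lam : Measure (Fin p → ℝ)) (S : Matrix (Fin p) (Fin p) ℝ) (n r : ℕ)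
    (v : ℝ) : Prop where
  memLp : ∀ j, MemLp (fun z : Fin p → ℝ => z j) r lam
  mean : ∀ j, ∫ z, z j ∂lam = 0
  second : ∀ j k, ∫ z, z j * z k ∂lam = S j k / n
  moment : ∀ j, ∀ k ≤ r, ∫ z, |z j| ^ k ∂lam ≤ v ^ k

variable {lam : Measure (Fin p → ℝ)} [IsProbabilityMeasure lam] {S : Matrix (Fin p) (Fin p) ℝ}
  {n r : ℕ} {v : ℝ}

theorem IsRowLaw.isBlockLaw (H : IsRowLaw lam S n r v) (hr : 1 ≤ r) (cell : Fin p → ι) (a : ι) :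
    IsBlockLaw (lam.map (restr cell a)) r (cellCard cell a * v) := by
  have hm := measurable_restr cell a
  have hi : ∀ j, Integrable (fun z : Fin p → ℝ => z j) lam := fun j => by
    simpa using integrable_pow_of_memLp (H.memLp j) hr
  refine ⟨fun j => ?_, fun w => ?_, fun k hk => ?_⟩
  · rw [memLp_map_measure_iff (measurable_pi_apply j).aestronglyMeasurable hm.aemeasurable]
    by_cases h : cell j = a
    · simpa [Function.comp_def, restr, h] using H.memLp j
    · simp [Function.comp_def, restr, h]
  · rw [integral_map hm.aemeasurable
      (by unfold dotProduct; fun_prop : Measurable fun z : Fin p → ℝ => z ⬝ᵥ w).aestronglyMeasurable]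
    have e : ∀ x : Fin p → ℝ, restr cell a x ⬝ᵥ w = ∑ j, x j * restr cell a w j := fun x =>
      restr_dotProduct cell a x w
    simp only [e]
    rw [integral_finsetSum _ fun j _ => (hi j).mul_const _]
    simp [integral_mul_const, H.mean]
  · rw [integral_map hm.aemeasurable (by fun_prop : Measurable fun z : Fin p → ℝ =>
      (∑ j, |z j|) ^ k).aestronglyMeasurable]
    have e : ∀ x : Fin p → ℝ, ∑ j, |restr cell a x j|
        = ∑ j ∈ Finset.univ.filter (fun l => cell l = a), |x j| := fun x => by
      rw [Finset.sum_filter]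
      exact Finset.sum_congr rfl fun j _ => by simp only [restr]; split_ifs <;> simp
    simp only [e]
    -- The power mean inequality over the cell produces `cellCard ^ k` for exponent `k + 1`, so
    -- exponent zero is separate.
    rcases k with _ | k
    · simp
    have hik : ∀ j, Integrable (fun z : Fin p → ℝ => |z j| ^ (k + 1)) lam := fun j =>
      integrable_pow_of_memLp (H.memLp j).norm hk
    have hil := integrable_pow_of_memLp
      (memLp_finsetSum (Finset.univ.filter fun l => cell l = a) fun j _ => (H.memLp j).norm) hk
    calc ∫ x : Fin p → ℝ, (∑ j ∈ Finset.univ.filter (fun l => cell l = a), |x j|) ^ (k + 1) ∂lam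
        ≤ ∫ x : Fin p → ℝ, (cellCard cell a : ℝ) ^ k *
            ∑ j ∈ Finset.univ.filter (fun l => cell l = a), |x j| ^ (k + 1) ∂lam :=
          integral_mono hil ((integrable_finsetSum _ fun j _ => hik j).const_mul _) fun x =>
            pow_sum_le_card_mul_sum_pow (fun j _ => abs_nonneg _) k
      _ = (cellCard cell a : ℝ) ^ k * ∑ j ∈ Finset.univ.filter (fun l => cell l = a),
            ∫ x : Fin p → ℝ, |x j| ^ (k + 1) ∂lam := by
          rw [integral_const_mul, integral_finsetSum _ fun j _ => hik j]
      _ ≤ (cellCard cell a : ℝ) ^ k * (cellCard cell a * v ^ (k + 1)) := by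
          refine mul_le_mul_of_nonneg_left ?_ (by positivity)
          rw [← nsmul_eq_mul]
          exact Finset.sum_le_card_nsmul _ _ _ fun j _ => H.moment j _ hk
      _ = _ := by ring

theorem IsRowLaw.integral_dotProduct_sq (H : IsRowLaw lam S n r v) (hr : 2 ≤ r) (u : Fin p → ℝ) :
    ∫ z, (z ⬝ᵥ u) ^ 2 ∂lam = (u ⬝ᵥ S *ᵥ u) / n := by
  have h2 : ∀ j, MemLp (fun z : Fin p → ℝ => z j) 2 lam := fun j =>
    (H.memLp j).mono_exponent (by exact_mod_cast hr)
  have hi : ∀ j k, Integrable (fun z : Fin p → ℝ => z j * z k) lam := fun j k =>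
    (h2 j).integrable_mul (h2 k)
  have e : ∀ z : Fin p → ℝ, (z ⬝ᵥ u) ^ 2 = ∑ j, ∑ k, (u j * u k) * (z j * z k) := fun z => by
    rw [sq, dotProduct, Finset.sum_mul_sum]
    exact Finset.sum_congr rfl fun j _ => Finset.sum_congr rfl fun k _ => by ring
  simp only [e]
  rw [integral_finsetSum _ fun j _ => integrable_finsetSum _ fun k _ => (hi j k).const_mul _]
  simp only [integral_finsetSum _ fun k _ => (hi _ k).const_mul _, integral_const_mul, H.second,
    dotProduct, Matrix.mulVec, Finset.sum_div, Finset.mul_sum]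
  exact Finset.sum_congr rfl fun j _ => Finset.sum_congr rfl fun k _ => by ring

theorem integral_map_restr_sq (H : IsRowLaw lam S n r v) (hr : 2 ≤ r) (cell : Fin p → ι) (a : ι)
    (w : Fin p → ℝ) : ∫ z, (z ⬝ᵥ w) ^ 2 ∂lam.map (restr cell a)
      = (restr cell a w ⬝ᵥ S *ᵥ restr cell a w) / n := by
  rw [integral_map (measurable_restr cell a).aemeasurable (by unfold dotProduct; fun_prop :
    Measurable fun z : Fin p → ℝ => (z ⬝ᵥ w) ^ 2).aestronglyMeasurable]
  have e : ∀ x : Fin p → ℝ, restr cell a x ⬝ᵥ w = x ⬝ᵥ restr cell a w := fun x =>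
    restr_dotProduct cell a x w
  simp only [e]
  exact H.integral_dotProduct_sq hr _

omit [IsProbabilityMeasure lam] in
theorem integral_mul_eq_zero_of_isBlockIndep (hmean : ∀ j, ∫ z, z j ∂lam = 0)
    {cell : Fin p → ι} (hb : IsBlockIndep lam cell) {j k : Fin p} (hjk : cell j ≠ cell k) :
    ∫ z, z j * z k ∂lam = 0 := by
  have hi := (hb.indepFun hjk).comp (measurable_pi_apply j) (measurable_pi_apply k)
  have e : ∀ l, ((fun x : Fin p → ℝ => x l) ∘ fun x => restr cell (cell l) x)
      = fun x : Fin p → ℝ => x l := fun l => by funext x; simp [restr]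
  rw [e, e] at hi
  rw [hi.integral_fun_mul_eq_mul_integral (measurable_pi_apply j).aestronglyMeasurable
    (measurable_pi_apply k).aestronglyMeasurable, hmean, zero_mul]

end

/-! ### Gluing independent copies -/

section glue

variable {p : ℕ} {ι ι' : Type*} [Fintype ι] [Fintype ι']

/-- The law of the vector whose subvectors on the intersections of the cells of two partitions
are taken from independent vectors with law `lam`. -/
def glue (lam : Measure (Fin p → ℝ)) (c : Fin p → ι) (c' : Fin p → ι') : Measure (Fin p → ℝ) :=
  (Measure.pi fun _ : ι => Measure.pi fun _ : ι' => lam).map fun x l => x (c l) (c' l) l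

variable {lam : Measure (Fin p → ℝ)} [IsProbabilityMeasure lam]

omit [Fintype ι] [Fintype ι'] in
theorem measurable_glue (c : Fin p → ι) (c' : Fin p → ι') :
    Measurable fun (x : ι → ι' → Fin p → ℝ) l => x (c l) (c' l) l := by
  fun_prop

theorem isProbabilityMeasure_glue (c : Fin p → ι) (c' : Fin p → ι') :
    IsProbabilityMeasure (glue lam c c') :=
  Measure.isProbabilityMeasure_map (measurable_glue c c').aemeasurable

/-- Both sides are images of the product measure over pairs of cells. It transfers independence
along `c` to independence along `c'`. -/
theorem glue_comm (c : Fin p → ι) (c' : Fin p → ι') : glue lam c c' = glue lam c' c := by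
  have h1 : IsProbabilityMeasure (Measure.pi fun _ : ι => lam) := inferInstance
  have h2 : IsProbabilityMeasure (Measure.pi fun _ : ι' => lam) := inferInstance
  have k1 : (Measure.pi fun _ : ι => Measure.pi fun _ : ι' => lam).map
      (fun x (y : ι × ι') => x y.1 y.2) = Measure.pi fun _ : ι × ι' => lam := by
    refine (Measure.pi_eq fun s hs => ?_).symm
    rw [Measure.map_apply (by fun_prop) (MeasurableSet.univ_pi hs)]
    have e : (fun (x : ι → ι' → Fin p → ℝ) (y : ι × ι') => x y.1 y.2) ⁻¹' Set.univ.pi s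
        = Set.univ.pi fun a => Set.univ.pi fun b => s (a, b) := by
      ext x; simp [Set.mem_pi]
    rw [e, Measure.pi_pi]
    simp only [Measure.pi_pi, Fintype.prod_prod_type]
  have k2 : (Measure.pi fun _ : ι' => Measure.pi fun _ : ι => lam).map
      (fun x (y : ι × ι') => x y.2 y.1) = Measure.pi fun _ : ι × ι' => lam := by
    refine (Measure.pi_eq fun s hs => ?_).symm
    rw [Measure.map_apply (by fun_prop) (MeasurableSet.univ_pi hs)]
    have e : (fun (x : ι' → ι → Fin p → ℝ) (y : ι × ι') => x y.2 y.1) ⁻¹' Set.univ.pi s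
        = Set.univ.pi fun b => Set.univ.pi fun a => s (a, b) := by
      ext x; simp only [Set.mem_preimage, Set.mem_pi, Set.mem_univ, true_implies, Prod.forall]
      exact forall_comm
    rw [e, Measure.pi_pi]
    simp only [Measure.pi_pi, Fintype.prod_prod_type_right]
  have hm : Measurable fun (y : ι × ι' → Fin p → ℝ) (l : Fin p) => y (c l, c' l) l := by fun_prop
  have e1 : glue lam c c' = (Measure.pi fun _ : ι × ι' => lam).map fun y l => y (c l, c' l) l := by
    rw [← k1, Measure.map_map hm (by fun_prop)]; rfl
  have e2 : glue lam c' c = (Measure.pi fun _ : ι × ι' => lam).map fun y l => y (c l, c' l) l := by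
    rw [← k2, Measure.map_map hm (by fun_prop)]; rfl
  rw [e1, e2]

variable [DecidableEq ι] [DecidableEq ι']

-- The cell `a` of the first partition reads only the copies with first index `a`, and these
-- families are independent for distinct `a`.
omit [DecidableEq ι'] in
theorem isBlockIndep_glue (c : Fin p → ι) (c' : Fin p → ι') : IsBlockIndep (glue lam c c') c := by
  rw [IsBlockIndep, glue, iIndepFun_map_iff (measurable_glue c c') (measurable_restr c)]
  have h := iIndepFun_pi (μ := fun _ : ι => Measure.pi fun _ : ι' => lam)
    (X := fun a (y : ι' → Fin p → ℝ) (l : Fin p) => if c l = a then y (c' l) l else 0)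
    fun a => (measurable_pi_lambda _ fun l => by
      by_cases h : c l = a <;> simp only [h, if_true, if_false] <;> fun_prop).aemeasurable
  convert h using 3 with a x
  funext l
  simp only [restr]
  split_ifs with hl
  · rw [hl]
  · rfl

omit [DecidableEq ι] in
theorem isBlockIndep_glue' (c : Fin p → ι) (c' : Fin p → ι') :
    IsBlockIndep (glue lam c c') c' := by
  rw [glue_comm]; exact isBlockIndep_glue c' c

/-- If two coordinates lie in the same cell for both partitions, they are read from one copy and
keep their covariance. Otherwise the glued covariance is zero, and so is the entry of `S`, by
independence under `lam` or under `lam'`. Both laws are therefore needed, although the marginals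
come from `lam` alone. -/
theorem isRowLaw_glue {lam' : Measure (Fin p → ℝ)} {S : Matrix (Fin p) (Fin p) ℝ} {n r : ℕ} {v : ℝ} (H : IsRowLaw lam S n r v) (H' : IsRowLaw lam' S n r v) {c : Fin p → ι}
    {c' : Fin p → ι'} (hc : IsBlockIndep lam c) (hc' : IsBlockIndep lam' c') :
    IsRowLaw (glue lam c c') S n r v := by
  have hg := isProbabilityMeasure_glue (lam := lam) c c'
  have hev : ∀ a b, MeasurePreserving (fun x : ι → ι' → Fin p → ℝ => x a b)
      (Measure.pi fun _ : ι => Measure.pi fun _ : ι' => lam) lam := fun a b =>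
    (measurePreserving_eval (fun _ : ι' => lam) b).comp
      (measurePreserving_eval (fun _ : ι => Measure.pi fun _ : ι' => lam) a)
  have hint : ∀ (a : ι) (b : ι') {f : (Fin p → ℝ) → ℝ}, Measurable f →
      ∫ x : ι → ι' → Fin p → ℝ, f (x a b)
        ∂(Measure.pi fun _ : ι => Measure.pi fun _ : ι' => lam) = ∫ z, f z ∂lam := by
    intro a b f hf
    have := integral_map (μ := Measure.pi fun _ : ι => Measure.pi fun _ : ι' => lam) (hev a b).measurable.aemeasurable
      (f := f) hf.aestronglyMeasurable
    rw [(hev a b).map_eq] at this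
    exact this.symm
  have hmap : ∀ {f : (Fin p → ℝ) → ℝ}, Measurable f → ∫ z, f z ∂glue lam c c'
      = ∫ x : ι → ι' → Fin p → ℝ, f (fun l => x (c l) (c' l) l)
        ∂(Measure.pi fun _ : ι => Measure.pi fun _ : ι' => lam) := fun hf =>
    integral_map (measurable_glue c c').aemeasurable hf.aestronglyMeasurable
  have hmem : ∀ j, MemLp (fun z : Fin p → ℝ => z j) r (glue lam c c') := fun j => by
    rw [glue, memLp_map_measure_iff (measurable_pi_apply j).aestronglyMeasurable
      (measurable_glue c c').aemeasurable]
    have := (H.memLp j).comp_measurePreserving (hev (c j) (c' j))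
    exact this
  have hmean : ∀ j, ∫ z, z j ∂glue lam c c' = 0 := fun j => by
    rw [hmap (measurable_pi_apply j), hint (c j) (c' j) (measurable_pi_apply j), H.mean]
  have hm2 : ∀ j k, Measurable fun z : Fin p → ℝ => z j * z k := fun j k => by fun_prop
  refine ⟨hmem, hmean, fun j k => ?_, fun j k hk => ?_⟩
  · by_cases h : c j = c k
    · by_cases h' : c' j = c' k
      · rw [hmap (hm2 j k), ← H.second, ← hint (c k) (c' k) (hm2 j k)]
        simp only [h, h']
      · rw [integral_mul_eq_zero_of_isBlockIndep hmean (isBlockIndep_glue' c c') h', ← H'.second,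
          integral_mul_eq_zero_of_isBlockIndep H'.mean hc' h']
    · rw [integral_mul_eq_zero_of_isBlockIndep hmean (isBlockIndep_glue c c') h, ← H.second,
        integral_mul_eq_zero_of_isBlockIndep H.mean hc h]
  · rw [hmap ((measurable_pi_apply j).abs.pow_const k),
      hint (c j) (c' j) ((measurable_pi_apply j).abs.pow_const k)]
    exact H.moment j k hk

end glue

/-! ### Quadratic forms and the largest eigenvalue. -/

theorem dotProduct_mulVec_le_of_eigenvalues_le {p : ℕ} {S : Matrix (Fin p) (Fin p) ℝ}
    (hS : S.IsHermitian) {M : ℝ} (hM : ∀ j, hS.eigenvalues j ≤ M) (u : Fin p → ℝ) :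
    u ⬝ᵥ S *ᵥ u ≤ M * ∑ j, u j ^ 2 := by
  have h : (M • (1 : Matrix (Fin p) (Fin p) ℝ) - S).PosSemidef := by
    have hd : (Matrix.diagonal fun j => M - hS.eigenvalues j).PosSemidef :=
      Matrix.PosSemidef.diagonal fun j => sub_nonneg.2 (hM j)
    have e : M • (1 : Matrix (Fin p) (Fin p) ℝ) - S = (hS.eigenvectorUnitary : Matrix _ _ ℝ) *
        (Matrix.diagonal fun j => M - hS.eigenvalues j) *
        (hS.eigenvectorUnitary : Matrix _ _ ℝ)ᴴ := by
      have e1 : (Matrix.diagonal fun j => M - hS.eigenvalues j)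
          = M • (1 : Matrix (Fin p) (Fin p) ℝ) - Matrix.diagonal hS.eigenvalues := by
        rw [← Matrix.diagonal_one, ← Matrix.diagonal_smul, Matrix.diagonal_sub]
        congr 1; funext j; simp
      have e2 := hS.spectral_theorem
      rw [Unitary.conjStarAlgAut_apply] at e2
      have e3 : (hS.eigenvectorUnitary : Matrix (Fin p) (Fin p) ℝ) *
          (hS.eigenvectorUnitary : Matrix _ _ ℝ)ᴴ = 1 := by
        rw [← Matrix.star_eq_conjTranspose]; exact Unitary.coe_mul_star_self _
      rw [e1, Matrix.mul_sub, Matrix.sub_mul, Matrix.mul_smul, Matrix.mul_one, Matrix.smul_mul, e3]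
      congr 1
    rw [e]
    exact hd.mul_mul_conjTranspose_same _
  have := h.dotProduct_mulVec_nonneg u
  simp only [star_trivial, Matrix.sub_mulVec, Matrix.smul_mulVec, Matrix.one_mulVec,
    dotProduct_sub, dotProduct_smul, smul_eq_mul] at this
  have e : u ⬝ᵥ u = ∑ j, u j ^ 2 := by simp [dotProduct, sq]
  rw [e] at this
  linarith

/-! ### Bounds in terms of the rate -/

theorem sigmaRate_two_mul (m n p d : ℕ) : sigmaRate (2 * m) n p d
    = (p : ℝ) * (d : ℝ) ^ (m + 3) / Real.sqrt n ^ 5 + (p : ℝ) * (d : ℝ) ^ 2 / Real.sqrt n ^ 3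
      + (p : ℝ) * (d : ℝ) ^ (2 * m + 2) / Real.sqrt n ^ (2 * m + 3) := by
  have hs : ∀ k : ℕ, Real.sqrt n ^ k = (n : ℝ) ^ ((k : ℝ) / 2) := fun k => by
    rw [Real.sqrt_eq_rpow, ← Real.rpow_natCast, ← Real.rpow_mul (Nat.cast_nonneg n)]
    congr 1; ring
  have hd : (d : ℝ) ^ (3 + ((2 * m : ℕ) : ℝ) / 2) = (d : ℝ) ^ (m + 3) := by
    rw [← Real.rpow_natCast]; congr 1; push_cast; ring
  rw [sigmaRate, hd, hs, hs, hs]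
  push_cast
  rfl

theorem sigmaRate_nonneg (b n p d : ℕ) : 0 ≤ sigmaRate b n p d := by
  unfold sigmaRate; positivity

section sums

variable {p : ℕ} {ι : Type*} [DecidableEq ι] [Fintype ι] {cell : Fin p → ι} {d : ℕ}

theorem sum_cellCard_pow_le (hd : ∀ a, cellCard cell a ≤ d) (k : ℕ) :
    ∑ a, (cellCard cell a : ℝ) ^ (k + 1) ≤ p * (d : ℝ) ^ k := by
  calc ∑ a, (cellCard cell a : ℝ) ^ (k + 1) ≤ ∑ a, (cellCard cell a : ℝ) * (d : ℝ) ^ k :=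
        Finset.sum_le_sum fun a _ => by
          rw [pow_succ']
          gcongr
          exact_mod_cast hd a
    _ = p * (d : ℝ) ^ k := by
        rw [← Finset.sum_mul]
        congr 1
        exact_mod_cast sum_cellCard cell

/-- Of the `2 j` powers of a cell size, `j - 2` are bounded by `p`, `j + 1` by `d`, and the last is
summed to `p`. Against `n ^ j` this leaves powers of `p / n` times `d ^ (j + 1) / n`. The split
requires `j ≥ 2`. -/
theorem sum_even_pow_le (hd : ∀ a, cellCard cell a ≤ d) {n : ℕ} (hn : 0 < n) {τ : ℝ}
    (hτ : 0 < τ) (hτ1 : τ ≤ 1) (hpn : (p : ℝ) / n ≤ 1 / τ) (L M : ℝ)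
    {j : ℕ} (hj : 2 ≤ j) :
    ∑ a, (L * (cellCard cell a * (M / Real.sqrt n))) ^ (2 * j)
      ≤ (L ^ 2 * (M ^ 2 / τ)) ^ j * (1 + (d : ℝ) ^ (j + 1) / n) := by
  obtain ⟨i, rfl⟩ := Nat.exists_eq_add_of_le hj
  have hn' : (0 : ℝ) < n := by exact_mod_cast hn
  have hsq : Real.sqrt n ^ 2 = n := Real.sq_sqrt hn'.le
  have hcp : ∀ a, (cellCard cell a : ℝ) ≤ p := fun a => by
    have := Finset.card_filter_le (Finset.univ : Finset (Fin p)) fun l => cell l = a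
    rw [Finset.card_univ, Fintype.card_fin] at this
    exact_mod_cast this
  have hsum : ∑ a, (cellCard cell a : ℝ) ^ (2 * (2 + i))
      ≤ (p : ℝ) ^ i * (p * (d : ℝ) ^ (2 + i + 1)) := by
    calc ∑ a, (cellCard cell a : ℝ) ^ (2 * (2 + i))
        = ∑ a, (cellCard cell a : ℝ) ^ i * (cellCard cell a : ℝ) ^ (2 + i + 1 + 1) :=
          Finset.sum_congr rfl fun a _ => by ring
      _ ≤ ∑ a, (p : ℝ) ^ i * (cellCard cell a : ℝ) ^ (2 + i + 1 + 1) :=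
          Finset.sum_le_sum fun a _ => by gcongr; exact_mod_cast hcp a
      _ ≤ _ := by
          rw [← Finset.mul_sum]
          exact mul_le_mul_of_nonneg_left (sum_cellCard_pow_le hd _) (by positivity)
  calc ∑ a, (L * (cellCard cell a * (M / Real.sqrt n))) ^ (2 * (2 + i))
      = (L ^ 2 * M ^ 2) ^ (2 + i) / (n : ℝ) ^ (2 + i)
          * ∑ a, (cellCard cell a : ℝ) ^ (2 * (2 + i)) := by
        rw [Finset.mul_sum]
        refine Finset.sum_congr rfl fun a _ => ?_
        rw [mul_pow, mul_pow, div_pow, pow_mul L, pow_mul M, pow_mul (Real.sqrt n), hsq, mul_pow]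
        ring
    _ ≤ (L ^ 2 * M ^ 2) ^ (2 + i) / (n : ℝ) ^ (2 + i)
          * ((p : ℝ) ^ i * (p * (d : ℝ) ^ (2 + i + 1))) := by gcongr
    _ = (L ^ 2 * M ^ 2) ^ (2 + i) * ((p : ℝ) / n) ^ (i + 1) * ((d : ℝ) ^ (2 + i + 1) / n) := by
        rw [div_pow]
        field_simp
        ring
    _ ≤ (L ^ 2 * M ^ 2) ^ (2 + i) * (1 / τ) ^ (2 + i) * (1 + (d : ℝ) ^ (2 + i + 1) / n) := by
        have h1 : ((p : ℝ) / n) ^ (i + 1) ≤ (1 / τ) ^ (2 + i) := by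
          refine (pow_le_pow_left₀ (by positivity) hpn _).trans ?_
          exact pow_le_pow_right₀ ((one_le_div hτ).2 hτ1) (by omega)
        gcongr
        linarith
    _ = _ := by rw [← mul_pow]; congr 2; ring

/-- The block bounds are summed with total variance `W = L ^ 2 * M ^ 2 / τ` and `Δ j = 1 + d ^ (j +
1) / n`. -/
theorem abs_integral_row_sub_le {lam lam' : Measure (Fin p → ℝ)} [IsProbabilityMeasure lam]
    [IsProbabilityMeasure lam'] {S : Matrix (Fin p) (Fin p) ℝ} {n m : ℕ} {M : ℝ} (hM : 1 ≤ M)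
    (H : IsRowLaw lam S n (2 * m + 3) (M / Real.sqrt n))
    (H' : IsRowLaw lam' S n (2 * m + 3) (M / Real.sqrt n))
    (hb : IsBlockIndep lam cell) (hb' : IsBlockIndep lam' cell)
    (hd : ∀ a, cellCard cell a ≤ d) (hd1 : 1 ≤ d) (hn : 0 < n) {τ : ℝ}
    (hτ : 0 < τ) (hτ1 : τ ≤ 1) (hpn : (p : ℝ) / n ≤ 1 / τ)
    (hS : ∀ u : Fin p → ℝ, u ⬝ᵥ S *ᵥ u ≤ M * ∑ j, u j ^ 2) {L : ℝ} (hL : 1 ≤ L)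
    {s : Finset (Fin p → ℝ)} (hs : s.Nonempty) (hw : ∀ w ∈ s, ∀ j, w j ∈ Set.Icc (-L) L)
    {c : (Fin p → ℝ) → ℝ} (hc : ∀ w ∈ s, 0 < c w) {h : (Fin p → ℝ) → ℝ} (hh : Continuous h)
    {K : ℝ} (hK : ∀ x, |h x| ≤ K) {C : ℝ} (hC : 0 ≤ C)
    (hswap : ∀ (μ ν : Measure (Fin p → ℝ)) [IsProbabilityMeasure μ] [IsProbabilityMeasure ν]
      (v : ℝ), IsBlockLaw μ (2 * m + 3) v → IsBlockLaw ν (2 * m + 3) v →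
      (∀ w : Fin p → ℝ, ∫ z, (z ⬝ᵥ w) ^ 2 ∂μ = ∫ z, (z ⬝ᵥ w) ^ 2 ∂ν) → ∀ y,
      |∫ z, h (y + z) ∂μ - ∫ z, h (y + z) ∂ν|
        ≤ C * ((L * v) ^ 3 * (1 + wavg s c (fun w => |y ⬝ᵥ w| ^ (2 * m)))
          + (L * v) ^ (2 * m + 3))) :
    |∫ x, h x ∂lam - ∫ x, h x ∂lam'|
      ≤ C * (2 * 8 ^ (m * m) * (M ^ 2 / τ) ^ m * M ^ (2 * m + 3)) * L ^ (2 * m + 3)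
        * sigmaRate (2 * m) n p d := by
  have hn' : (0 : ℝ) < n := by exact_mod_cast hn
  have hL0 : 0 ≤ L := by linarith
  have hM0 : 0 ≤ M := by linarith
  have hd1' : (1 : ℝ) ≤ d := by exact_mod_cast hd1
  set r := Real.sqrt n with hr
  have hr0 : 0 < r := Real.sqrt_pos.2 hn'
  have hr2 : r ^ 2 = n := Real.sq_sqrt hn'.le
  have hm := fun a => measurable_restr cell a
  set G := M ^ 2 / τ with hG
  have hG1 : 1 ≤ G := by
    rw [hG, one_le_div hτ]; exact hτ1.trans (one_le_pow₀ hM)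
  set Δ : ℕ → ℝ := fun j => 1 + (d : ℝ) ^ (j + 1) / n with hΔ
  have hΔm : Monotone Δ := fun i j hij => by
    simp only [hΔ]
    gcongr
  have hΔ1 : ∀ j, 1 ≤ Δ j := fun j => le_add_of_nonneg_right (by positivity)
  have hprob : ∀ (μ : Measure (Fin p → ℝ)) [IsProbabilityMeasure μ] (a : ι),
      IsProbabilityMeasure (μ.map (restr cell a)) := fun μ _ a =>
    Measure.isProbabilityMeasure_map (hm a).aemeasurable
  have hbl : ∀ a, IsBlockLaw (lam.map (restr cell a)) (2 * m + 3) (cellCard cell a * (M / r)) :=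
    fun a => H.isBlockLaw (by omega) cell a
  have hbl' : ∀ a, IsBlockLaw (lam'.map (restr cell a)) (2 * m + 3) (cellCard cell a * (M / r)) :=
    fun a => H'.isBlockLaw (by omega) cell a
  have hcov : ∀ a (w : Fin p → ℝ), ∫ z, (z ⬝ᵥ w) ^ 2 ∂lam.map (restr cell a)
      = ∫ z, (z ⬝ᵥ w) ^ 2 ∂lam'.map (restr cell a) := fun a w => by
    rw [integral_map_restr_sq H (by omega), integral_map_restr_sq H' (by omega)]
  -- The eigenvalue bound is used here: the block variances sum to at most `M L ^ 2 p / n`. The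
  -- crude `ℓ¹` bound would cost a factor `d`.
  have hsec : ∀ w ∈ s, ∑ a, ∫ z, (z ⬝ᵥ w) ^ 2 ∂lam.map (restr cell a) ≤ L ^ 2 * G := by
    intro w hws
    have h1 : ∀ a, ∫ z, (z ⬝ᵥ w) ^ 2 ∂lam.map (restr cell a)
        ≤ (cellCard cell a : ℝ) * (M * L ^ 2 / n) := fun a => by
      rw [integral_map_restr_sq H (by omega)]
      have h2 : ∑ j, restr cell a w j ^ 2 ≤ cellCard cell a * L ^ 2 := by
        have : ∀ j, restr cell a w j ^ 2 ≤ if cell j = a then L ^ 2 else 0 := fun j => by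
          simp only [restr]
          split_ifs
          · exact sq_le_sq' (hw w hws j).1 (hw w hws j).2
          · simp
        refine (Finset.sum_le_sum fun j _ => this j).trans (le_of_eq ?_)
        rw [← Finset.sum_filter, Finset.sum_const, nsmul_eq_mul]
        rfl
      calc (restr cell a w ⬝ᵥ S *ᵥ restr cell a w) / n ≤ M * (cellCard cell a * L ^ 2) / n := by
            gcongr
            exact (hS _).trans (mul_le_mul_of_nonneg_left h2 hM0)
        _ = _ := by ring
    refine (Finset.sum_le_sum fun a _ => h1 a).trans ?_
    rw [← Finset.sum_mul]
    have h3 : ∑ a, (cellCard cell a : ℝ) = p := by exact_mod_cast sum_cellCard cell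
    rw [h3]
    calc (p : ℝ) * (M * L ^ 2 / n) = L ^ 2 * (M * ((p : ℝ) / n)) := by ring
      _ ≤ L ^ 2 * (M ^ 2 * (1 / τ)) := by
          gcongr
          exact le_self_pow₀ hM (by norm_num)
      _ = _ := by rw [hG]; ring
  have hW1 : 1 ≤ L ^ 2 * G := one_le_mul_of_one_le_of_one_le (one_le_pow₀ hL) hG1
  have main := abs_integral_pi_sum_sub_le (fun a => by positivity) hbl hbl' hcov hL0
    (by linarith : 0 ≤ L ^ 2 * G) hΔm hΔ1
    (fun j hj _ => sum_even_pow_le hd hn hτ hτ1 hpn L M hj) hs hw hsec hc hh hK hC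
    (fun a y => hswap _ _ _ (hbl a) (hbl' a) (hcov a) y)
  have hint : ∀ {μ : Measure (Fin p → ℝ)} [IsProbabilityMeasure μ], IsBlockIndep μ cell →
      ∫ x : ι → Fin p → ℝ, h (∑ a, x a) ∂Measure.pi (fun a => μ.map (restr cell a))
        = ∫ x, h x ∂μ := by
    intro μ _ hμ
    conv_rhs => rw [hμ.eq_map_sum]
    rw [integral_map (by fun_prop : Measurable fun x : ι → Fin p → ℝ => ∑ a, x a).aemeasurable
      hh.measurable.aestronglyMeasurable]
  rw [hint hb, hint hb'] at main
  refine main.trans ?_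
  have s3 : ∑ a, (L * (cellCard cell a * (M / r))) ^ 3 ≤ (L * M / r) ^ 3 * (p * (d : ℝ) ^ 2) := by
    refine le_trans (le_of_eq ?_)
      (mul_le_mul_of_nonneg_left (sum_cellCard_pow_le hd 2) (by positivity))
    rw [Finset.mul_sum]
    exact Finset.sum_congr rfl fun a _ => by ring
  have sb : ∑ a, (L * (cellCard cell a * (M / r))) ^ (2 * m + 3)
      ≤ (L * M / r) ^ (2 * m + 3) * (p * (d : ℝ) ^ (2 * m + 2)) := by
    refine le_trans (le_of_eq ?_)
      (mul_le_mul_of_nonneg_left (sum_cellCard_pow_le hd (2 * m + 2)) (by positivity))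
    rw [Finset.mul_sum]
    exact Finset.sum_congr rfl fun a _ => by rw [← mul_pow]; ring
  set A := 2 * 8 ^ (m * m) * G ^ m with hA
  have hA1 : 1 ≤ A := by
    have h1 : (1 : ℝ) ≤ 8 ^ (m * m) := one_le_pow₀ (by norm_num)
    have h2 : 1 ≤ G ^ m := one_le_pow₀ hG1
    nlinarith
  have hY : 1 + 8 ^ (m * m) * (L ^ 2 * G) ^ m * Δ m ≤ A * L ^ (2 * m) * Δ m := by
    have h1 : (1 : ℝ) ≤ 8 ^ (m * m) * (L ^ 2 * G) ^ m * Δ m :=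
      one_le_mul_of_one_le_of_one_le (one_le_mul_of_one_le_of_one_le (one_le_pow₀ (by norm_num))
        (one_le_pow₀ hW1)) (hΔ1 m)
    have e : A * L ^ (2 * m) * Δ m = 2 * (8 ^ (m * m) * (L ^ 2 * G) ^ m * Δ m) := by
      rw [hA, mul_pow, ← pow_mul]; ring
    linarith
  have hM3 : M ^ 3 ≤ M ^ (2 * m + 3) := pow_le_pow_right₀ hM (by omega)
  rw [← Finset.mul_sum, Finset.sum_add_distrib, ← Finset.sum_mul,
    mul_assoc C, mul_assoc C]
  refine mul_le_mul_of_nonneg_left ?_ hC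
  have hΔ0 := zero_le_one.trans (hΔ1 m)
  have hT : ∀ {k : ℕ}, 0 ≤ (L * M / r) ^ k := fun {k} => by positivity
  -- Expanding `Δ m` splits `p d ^ 2 / r ^ 3 * Δ m` into the first two terms of the rate; the power
  -- `2 * m + 3` gives the third.
  calc _ ≤ (L * M / r) ^ 3 * (p * (d : ℝ) ^ 2) * (A * L ^ (2 * m) * Δ m)
        + (L * M / r) ^ (2 * m + 3) * (p * (d : ℝ) ^ (2 * m + 2)) := by
        refine add_le_add (mul_le_mul s3 hY ?_ (by positivity)) sb
        positivity
    _ = A * M ^ 3 * L ^ (2 * m + 3) * (p * (d : ℝ) ^ (m + 3) / r ^ 5 + p * (d : ℝ) ^ 2 / r ^ 3)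
        + 1 * M ^ (2 * m + 3) * L ^ (2 * m + 3) *
          (p * (d : ℝ) ^ (2 * m + 2) / r ^ (2 * m + 3)) := by
        simp only [hΔ, ← hr2, div_pow, mul_pow]
        field_simp
        ring
    _ ≤ A * M ^ (2 * m + 3) * L ^ (2 * m + 3) *
          (p * (d : ℝ) ^ (m + 3) / r ^ 5 + p * (d : ℝ) ^ 2 / r ^ 3)
        + A * M ^ (2 * m + 3) * L ^ (2 * m + 3) *
          (p * (d : ℝ) ^ (2 * m + 2) / r ^ (2 * m + 3)) := by gcongr
    _ = _ := by rw [sigmaRate_two_mul]; ring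

end sums

/-! ### Replacing all rows -/

theorem abs_iteratedDeriv_le_Kg {g : ℝ → ℝ} (hg : BoundedDerivs g) (k : Fin 4) (x : ℝ) :
    |iteratedDeriv (k : ℕ) g x| ≤ Kg g := by
  have h1 := le_ciSup (hg k) x
  have h2 := le_ciSup (f := fun k : Fin 4 => ⨆ x : ℝ, |iteratedDeriv (k : ℕ) g x|)
    (Set.finite_range _).bddAbove k
  rw [Kg]
  linarith

theorem Kg_nonneg {g : ℝ → ℝ} (hg : BoundedDerivs g) : 0 ≤ Kg g :=
  (abs_nonneg _).trans (abs_iteratedDeriv_le_Kg hg 0 0)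

section

variable {n p : ℕ}

theorem exp_risk_eq (hn : 0 < n) (β : ℝ) (ℓ : Fin n → ℝ → ℝ) (R : (Fin p → ℝ) → ℝ)
    (x : Fin n → Fin p → ℝ) (w : Fin p → ℝ) :
    Real.exp (-β * (n * risk ℓ R w x))
      = Real.exp (-β * (∑ i, ℓ i (x i ⬝ᵥ w) + n * R w)) := by
  have : (n : ℝ) ≠ 0 := by exact_mod_cast hn.ne'
  rw [risk]
  congr 2
  field_simp

/-- The energy is additive over rows, so the other rows and `R` enter only through positive weights
independent of `z`. -/
theorem normalizedSoftMin_update (hn : 0 < n) (β : ℝ) (s : Finset (Fin p → ℝ))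
    (ℓ : Fin n → ℝ → ℝ) (R : (Fin p → ℝ) → ℝ) (x : Fin n → Fin p → ℝ) (i : Fin n)
    (g : ℝ → ℝ) (z : Fin p → ℝ) :
    g (normalizedSoftMin β s ℓ R (Function.update x i z))
      = rowFun g n s (fun w => Real.exp (-β * (∑ j ∈ Finset.univ.erase i, ℓ j (x j ⬝ᵥ w)
          + n * R w))) β (ℓ i) z := by
  rw [rowFun, normalizedSoftMin, softMin, softVal]
  congr 4
  refine Finset.sum_congr rfl fun w _ => ?_
  rw [exp_risk_eq hn, ← Real.exp_add, ← Finset.add_sum_erase _ _ (Finset.mem_univ i)]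
  have : ∑ j ∈ Finset.univ.erase i, ℓ j (Function.update x i z j ⬝ᵥ w)
      = ∑ j ∈ Finset.univ.erase i, ℓ j (x j ⬝ᵥ w) :=
    Finset.sum_congr rfl fun j hj => by rw [Function.update_of_ne (Finset.ne_of_mem_erase hj)]
  rw [this, Function.update_self]
  congr 1
  ring

theorem continuous_normalizedSoftMin (hn : 0 < n) (β : ℝ) {s : Finset (Fin p → ℝ)}
    (hs : s.Nonempty) {ℓ : Fin n → ℝ → ℝ} (hℓ : ∀ i, Continuous (ℓ i)) (R : (Fin p → ℝ) → ℝ) :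
    Continuous (normalizedSoftMin β s ℓ R) := by
  have h1 : ∀ (i : Fin n) (w : Fin p → ℝ),
      Continuous fun x : Fin n → Fin p → ℝ => x i ⬝ᵥ w := fun i w => by
    unfold dotProduct; fun_prop
  have h2 : ∀ w : Fin p → ℝ, Continuous fun x : Fin n → Fin p → ℝ =>
      Real.exp (-β * (n * risk ℓ R w x)) := fun w => by
    simp only [exp_risk_eq hn]
    exact Real.continuous_exp.comp (continuous_const.mul ((continuous_finsetSum _ fun i _ =>
      (hℓ i).comp (h1 i w)).add continuous_const))
  exact continuous_const.mul (continuous_const.mul ((continuous_finsetSum _ fun w _ => h2 w).log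
    fun x => (Finset.sum_pos (fun w _ => Real.exp_pos _) hs).ne'))

/-- Row by row replacement. The bound for one row is uniform in the other rows, so integrating over
the hybrid costs nothing; summing the constants `C i`, each with a factor `1 / n`, produces `Av Lc
(qMax q)`. -/
theorem abs_integral_pi_sub_le_of_common_partition {ι : Type*} [Fintype ι] [DecidableEq ι]
    {cell : Fin p → ι} {d : ℕ} {lam lam' : Measure (Fin p → ℝ)}
    [IsProbabilityMeasure lam] [IsProbabilityMeasure lam'] {S : Matrix (Fin p) (Fin p) ℝ}
    {q : Fin 4 → ℝ} {M : ℝ} (hM : 1 ≤ M)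
    (H : IsRowLaw lam S n (qBar q + 3) (M / Real.sqrt n))
    (H' : IsRowLaw lam' S n (qBar q + 3) (M / Real.sqrt n))
    (hb : IsBlockIndep lam cell) (hb' : IsBlockIndep lam' cell)
    (hd : ∀ a, cellCard cell a ≤ d) (hd1 : 1 ≤ d) (hn : 0 < n) {τ : ℝ}
    (hτ : 0 < τ) (hτ1 : τ ≤ 1) (hpn : (p : ℝ) / n ≤ 1 / τ)
    (hS : ∀ u : Fin p → ℝ, u ⬝ᵥ S *ᵥ u ≤ M * ∑ j, u j ^ 2) {L : ℝ} (hL : 1 ≤ L)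
    {s : Finset (Fin p → ℝ)} (hs : s.Nonempty) (hw : ∀ w ∈ s, ∀ j, w j ∈ Set.Icc (-L) L)
    {ℓ : Fin n → ℝ → ℝ} {ℓs : Fin n → ℝ → ℝ → ℝ} {ρbar : ℝ} {Lc : Fin n → ℝ} {D A : ℝ → ℝ}
    (hℓ : LossAssumption q ℓ ℓs ρbar Lc D A) (R : (Fin p → ℝ) → ℝ) {ρ : ℝ}
    (hρ : ρ ∈ Set.Ioo 0 ρbar) {β : ℝ} (hβ : 0 < β) {g : ℝ → ℝ} (hg : ContDiff ℝ 3 g)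
    (hgb : BoundedDerivs g) {m : ℕ} (hm : qBar q = 2 * m) :
    |∫ x, g (normalizedSoftMin β s (fun i => ℓs i ρ) R x) ∂Measure.pi (fun _ : Fin n => lam)
      - ∫ x, g (normalizedSoftMin β s (fun i => ℓs i ρ) R x) ∂Measure.pi (fun _ : Fin n => lam')|
    ≤ 140 * 2 ^ (2 * m) * 8 * 3 ^ qMax q * (2 * 8 ^ (m * m) * (M ^ 2 / τ) ^ m * M ^ (2 * m + 3))
        * Kg g * max 1 (β ^ 2) * L ^ (qBar q + 3) * (D ρ) ^ 3 * Av Lc (qMax q)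
        * sigmaRate (qBar q) n p d := by
  have hQ := qMax_nonneg hℓ.q_nonneg
  have hD := hℓ.one_le_D ρ hρ
  have hn1 : (1 : ℝ) ≤ n := by exact_mod_cast hn
  have hK := Kg_nonneg hgb
  have hgk := abs_iteratedDeriv_le_Kg hgb
  have hg0 : ∀ x, |g x| ≤ Kg g := fun x => by simpa using hgk 0 x
  have hgc : Continuous g := hg.continuous
  have hℓc : ∀ i, Continuous (ℓs i ρ) := fun i => (hℓ.smooth_contDiff i ρ hρ).continuous
  have hL1 : ∀ i, 0 ≤ Lc i := fun i => zero_le_one.trans (hℓ.one_le_Lc i)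
  rw [hm] at H H' ⊢
  set c₁ := 2 * 8 ^ (m * m) * (M ^ 2 / τ) ^ m * M ^ (2 * m + 3) with hc₁
  set C : Fin n → ℝ := fun i => 140 * 2 ^ (2 * m) *
    (Kg g * max 1 (β ^ 2) * (8 * D ρ ^ 3) * (3 ^ qMax q * Lc i ^ qMax q) / n) with hC
  have hC0 : ∀ i, 0 ≤ C i := fun i => by
    have := Real.rpow_nonneg (hL1 i) (qMax q)
    positivity
  have main := abs_sub_le_sum_of_swap (fun κ : Fin n → Measure (Fin p → ℝ) =>
    ∫ x, g (normalizedSoftMin β s (fun i => ℓs i ρ) R x) ∂Measure.pi κ) (fun _ => lam)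
    (fun _ => lam') (fun i => C i * c₁ * L ^ (2 * m + 3) * sigmaRate (2 * m) n p d) ?_
  · refine main.trans (le_of_eq ?_)
    rw [← Finset.sum_mul, ← Finset.sum_mul, ← Finset.sum_mul]
    have : ∑ i, C i = 140 * 2 ^ (2 * m) * 8 * 3 ^ qMax q * Kg g * max 1 (β ^ 2) * D ρ ^ 3
        * Av Lc (qMax q) := by
      rw [Av, ← mul_assoc, Finset.mul_sum]
      exact Finset.sum_congr rfl fun i _ => by simp only [hC]; ring
    rw [this]
    ring
  · intro κ hκ i
    have : ∀ a, IsProbabilityMeasure (κ a) := fun a => by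
      rcases hκ a with e | e <;> rw [e] <;> infer_instance
    have hrow : ∀ x : Fin n → Fin p → ℝ,
        |∫ z, g (normalizedSoftMin β s (fun i => ℓs i ρ) R (Function.update x i z)) ∂lam
          - ∫ z, g (normalizedSoftMin β s (fun i => ℓs i ρ) R (Function.update x i z)) ∂lam'|
          ≤ C i * c₁ * L ^ (2 * m + 3) * sigmaRate (2 * m) n p d := by
      intro x
      simp only [normalizedSoftMin_update hn]
      set c : (Fin p → ℝ) → ℝ := fun w =>
        Real.exp (-β * (∑ j ∈ Finset.univ.erase i, ℓs j ρ (x j ⬝ᵥ w) + n * R w))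
      have hc : ∀ w ∈ s, 0 < c w := fun w _ => Real.exp_pos _
      refine abs_integral_row_sub_le hM H H' hb hb' hd hd1 hn hτ hτ1 hpn hS hL hs hw hc
        (continuous_rowFun hgc n hs hc β (hℓc i)) (fun z => hg0 _) (hC0 i) ?_
      intro μ ν _ _ v hμ hν hcov y
      have hH := hℓ.max_one_rpow_le i hρ
      rw [hm] at hH
      exact abs_integral_rowFun_sub_le hμ hν hcov hs hc (by linarith) hw hβ hQ
        (by positivity) (hℓ.selfBounded i hρ)
        (mul_nonneg (by positivity) (Real.rpow_nonneg (hL1 i) _)) hH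
        (fun x => by simpa using hasDerivAt_iteratedDeriv hg (k := 0) (by norm_num) x)
        (hasDerivAt_iteratedDeriv hg (k := 1) (by norm_num))
        (hasDerivAt_iteratedDeriv hg (k := 2) (by norm_num)) hg0 (hgk 1) (hgk 2) (hgk 3) hn1 y
    refine (abs_integral_pi_update_sub_le κ lam lam' i
      (hgc.comp (continuous_normalizedSoftMin hn β hs hℓc R)).measurable (fun x => hg0 _)
      (integrable_const _) hrow).trans (le_of_eq ?_)
    simp

/-! ### Laws of the rows of a design -/

variable {Ω : Type*} [MeasurableSpace Ω] {P : Measure Ω} [IsProbabilityMeasure P]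

theorem integral_abs_pow_le_of_eLpNorm_le {f : Ω → ℝ} {k : ℕ} {M : ℝ} (hM : 0 ≤ M)
    (hf : MemLp f k P) (h : eLpNorm f k P ≤ ENNReal.ofReal M) : ∫ ω, |f ω| ^ k ∂P ≤ M ^ k := by
  rcases Nat.eq_zero_or_pos k with rfl | hk
  · simp
  have hk0 : ((k : ℕ) : ℝ≥0∞) ≠ 0 := by exact_mod_cast hk.ne'
  have hk' : (k : ℝ) ≠ 0 := by exact_mod_cast hk.ne'
  rw [hf.eLpNorm_eq_integral_rpow_norm hk0 (ENNReal.natCast_ne_top k),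
    ENNReal.ofReal_le_ofReal_iff hM] at h
  simp only [ENNReal.toReal_natCast, Real.rpow_natCast, Real.norm_eq_abs] at h
  have h0 : 0 ≤ ∫ ω, |f ω| ^ k ∂P := integral_nonneg fun ω => by positivity
  have := pow_le_pow_left₀ (Real.rpow_nonneg h0 _) h k
  rwa [← Real.rpow_natCast, ← Real.rpow_mul h0, inv_mul_cancel₀ hk', Real.rpow_one] at this

/-- With `qBar = 2 m` the order `qStar` equals `2 ^ (m + 2)`, which dominates the order `2 m + 3`
needed for the Taylor remainder. -/
theorem qBar_add_three_le_qStar (q : Fin 4 → ℝ) : ((qBar q + 3 : ℕ) : ℝ) ≤ qStar q := by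
  set m := ⌈q 0 * qMax q / 2⌉₊ with hm
  have e : qStar q = ((2 ^ (m + 2) : ℕ) : ℝ) := by
    rw [qStar, qBar, ← hm]
    push_cast
    rw [← Real.rpow_natCast]
    congr 1
    push_cast
    ring
  rw [e, qBar, ← hm]
  have : 2 * m + 3 ≤ 2 ^ (m + 2) := by
    clear_value m
    clear hm e
    induction m with
    | zero => norm_num
    | succ m ih => rw [pow_succ]; omega
  exact_mod_cast this

variable {d : ℕ} {S : Matrix (Fin p) (Fin p) ℝ} {q : Fin 4 → ℝ} {M : ℝ} {Z : Fin n → Ω → Fin p → ℝ}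

theorem IsDesign.isRowLaw (H : IsDesign P d S (qStar q) M Z) (hn : 0 < n) (hM : 0 ≤ M)
    (i : Fin n) : IsRowLaw (P.map (Z i)) S n (qBar q + 3) (M / Real.sqrt n) := by
  have hm := H.measurable i
  have hmj : ∀ j, Measurable fun ω => Z i ω j := fun j => (measurable_pi_apply j).comp hm
  have hr : 0 < Real.sqrt n := Real.sqrt_pos.2 (by exact_mod_cast hn)
  have hle : ∀ k ≤ qBar q + 3, ∀ j,
      eLpNorm (fun ω => Real.sqrt n * Z i ω j) k P ≤ ENNReal.ofReal M := fun k hk j => by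
    refine (eLpNorm_le_eLpNorm_of_exponent_le ?_
      ((hmj j).const_mul _).aestronglyMeasurable).trans (H.moment i j)
    rw [← ENNReal.ofReal_natCast]
    exact ENNReal.ofReal_le_ofReal ((Nat.cast_le.2 hk).trans (qBar_add_three_le_qStar q))
  have hmem : ∀ k ≤ qBar q + 3, ∀ j, MemLp (fun ω => Real.sqrt n * Z i ω j) k P := fun k hk j =>
    ⟨((hmj j).const_mul _).aestronglyMeasurable, (hle k hk j).trans_lt ENNReal.ofReal_lt_top⟩
  refine ⟨fun j => ?_, fun j => ?_, fun j k => ?_, fun j k hk => ?_⟩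
  · rw [memLp_map_measure_iff (measurable_pi_apply j).aestronglyMeasurable hm.aemeasurable]
    have := (hmem _ le_rfl j).const_mul (Real.sqrt n)⁻¹
    simp only [inv_mul_cancel_left₀ hr.ne'] at this
    exact this
  · rw [integral_map hm.aemeasurable (measurable_pi_apply j).aestronglyMeasurable]
    exact H.mean i j
  · rw [integral_map hm.aemeasurable
      (by fun_prop : Measurable fun z : Fin p → ℝ => z j * z k).aestronglyMeasurable]
    exact H.secondMoment i j k
  · rw [integral_map hm.aemeasurable
      (by fun_prop : Measurable fun z : Fin p → ℝ => |z j| ^ k).aestronglyMeasurable]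
    have := integral_abs_pow_le_of_eLpNorm_le hM (hmem k hk j) (hle k hk j)
    simp only [abs_mul, mul_pow, abs_of_pos hr] at this
    rw [integral_const_mul] at this
    rw [div_pow, le_div_iff₀ (by positivity)]
    linarith

omit [IsProbabilityMeasure P] in
theorem IsDesign.mono {r M' : ℝ} (H : IsDesign P d S r M Z) (h : M ≤ M') :
    IsDesign P d S r M' Z :=
  { H with moment := fun i j => (H.moment i j).trans (ENNReal.ofReal_le_ofReal h) }

omit [IsProbabilityMeasure P] in
theorem IsDesign.map_eq_pi {r : ℝ} (H : IsDesign P d S r M Z) (i : Fin n) :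
    P.map (fun ω j => Z j ω) = Measure.pi fun _ : Fin n => P.map (Z i) := by
  rw [H.indep.map_fun_eq_pi_map fun j => (H.measurable j).aemeasurable]
  congr 1
  funext j
  exact (H.identDistrib j i).map_eq

omit [IsProbabilityMeasure P] in
theorem IsDesign.integral_eq {r : ℝ} (H : IsDesign P d S r M Z) (i : Fin n)
    {f : (Fin n → Fin p → ℝ) → ℝ} (hf : Measurable f) :
    ∫ ω, f (fun j => Z j ω) ∂P = ∫ x, f x ∂Measure.pi fun _ : Fin n => P.map (Z i) := by
  rw [← H.map_eq_pi i, integral_map (measurable_pi_lambda _ H.measurable).aemeasurable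
    hf.aestronglyMeasurable]

theorem IsBlockDependent.exists_cell {X : Ω → Fin p → ℝ} (hX : Measurable X)
    (h : IsBlockDependent P d X) : ∃ (k : ℕ) (cell : Fin p → Fin k),
      (∀ a, cellCard cell a ≤ d) ∧ IsBlockIndep (P.map X) cell := by
  obtain ⟨k, B, -, hdisj, hcov, hcard, hind⟩ := h
  choose cell hcell using hcov
  have hiff : ∀ l a, cell l = a ↔ l ∈ B a := fun l a => by
    refine ⟨fun h => h ▸ hcell l, fun h => ?_⟩
    by_contra hne
    exact Finset.disjoint_left.1 (hdisj _ _ hne) (hcell l) h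
  refine ⟨k, cell, fun a => ?_, ?_⟩
  · have : Finset.univ.filter (fun l => cell l = a) = B a := by ext l; simp [hiff]
    rw [cellCard, this]
    exact hcard a
  · rw [IsBlockIndep, iIndepFun_map_iff hX (measurable_restr cell)]
    have := hind.comp (fun a (y : B a → ℝ) (l : Fin p) => if h : l ∈ B a then y ⟨l, h⟩ else 0)
      fun a => measurable_pi_lambda _ fun l => by
        by_cases h : l ∈ B a
        · simpa only [h, dite_true] using measurable_pi_apply _
        · simp only [h, dite_false]; fun_prop
    convert this using 3 with a ω
    funext l
    simp [restr, hiff]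

end

end BlockUniversality

end

/-! ### The theorem: comparison through the glued law. -/

theorem proposition1 (τ : ℝ) (hτ : τ ∈ Set.Ioo (0 : ℝ) 1) (q : Fin 4 → ℝ) (M : ℝ) :
    ∃ C₀ : ℝ, 0 < C₀ ∧
      ∀ (n p d : ℕ), BlockUniversality.ProportionalRegime τ n p →
      ∀ (ℓ : Fin n → ℝ → ℝ) (ℓs : Fin n → ℝ → ℝ → ℝ) (ρbar : ℝ) (Lc : Fin n → ℝ) (D A : ℝ → ℝ),
        BlockUniversality.LossAssumption q ℓ ℓs ρbar Lc D A →
      ∀ (R : (Fin p → ℝ) → ℝ)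
        (S : Matrix (Fin p) (Fin p) ℝ) (hS : S.PosDef),
        (∀ j, hS.isHermitian.eigenvalues j ≤ M) →
      ∀ (Ω : Type*) [MeasurableSpace Ω] (P : Measure Ω) [IsProbabilityMeasure P]
        (X : Fin n → Ω → Fin p → ℝ),
        BlockUniversality.IsDesign P d S (BlockUniversality.qStar q) M X →
      ∀ (Ω' : Type*) [MeasurableSpace Ω'] (P' : Measure Ω') [IsProbabilityMeasure P']
        (W : Fin n → Ω' → Fin p → ℝ),
        BlockUniversality.IsDesign P' d S (BlockUniversality.qStar q) M W →
      ∀ (L : ℝ), 1 ≤ L →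
      ∀ (s : Finset (Fin p → ℝ)), (∀ w ∈ s, ∀ j, w j ∈ Set.Icc (-L) L) →
      ∀ ρ ∈ Set.Ioo 0 ρbar, ∀ (β : ℝ), 0 < β →
      ∀ (g : ℝ → ℝ), ContDiff ℝ 3 g → BlockUniversality.BoundedDerivs g →
        |(∫ ω, g (BlockUniversality.normalizedSoftMin β s (fun i => ℓs i ρ) R
              (fun i => X i ω)) ∂P)
          - ∫ ω, g (BlockUniversality.normalizedSoftMin β s (fun i => ℓs i ρ) R
              (fun i => W i ω)) ∂P'|
        ≤ C₀ * BlockUniversality.Kg g * max 1 (β ^ 2) * L ^ (BlockUniversality.qBar q + 3)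
            * (D ρ) ^ 3 * BlockUniversality.Av Lc (BlockUniversality.qMax q)
            * BlockUniversality.sigmaRate (BlockUniversality.qBar q) n p d := by
  open BlockUniversality in
  obtain ⟨hτ0, hτ1⟩ := hτ
  set m := ⌈q 0 * qMax q / 2⌉₊ with hm
  -- The given `M` is an arbitrary real number; enlarging it to at least `1` makes its powers
  -- monotone.
  set M₁ := max M 1 with hM₁
  have hM1 : 1 ≤ M₁ := le_max_right _ _
  have hMM : M ≤ M₁ := le_max_left _ _
  set C := 140 * 2 ^ (2 * m) * 8 * 3 ^ qMax q *
    (2 * 8 ^ (m * m) * (M₁ ^ 2 / τ) ^ m * M₁ ^ (2 * m + 3)) with hC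
  have hC0 : 0 < C := by positivity
  -- One copy of `C` for each of the two comparisons with the glued law.
  refine ⟨2 * C, by positivity, ?_⟩
  intro n p d ⟨hn, hpn0, hpn⟩ ℓ ℓs ρbar Lc D A hℓ R S hS hSM Ω _ P _ X hX Ω' _ P' _ W hW L hL s hs
    ρ hρ β hβ g hg hgb
  have hD := hℓ.one_le_D ρ hρ
  have hK := Kg_nonneg hgb
  have hAv : 0 ≤ Av Lc (qMax q) := mul_nonneg (by positivity) (Finset.sum_nonneg fun i _ =>
    Real.rpow_nonneg (zero_le_one.trans (hℓ.one_le_Lc i)) _)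
  have hσ := sigmaRate_nonneg (qBar q) n p d
  -- For empty `s` the convention `Real.log 0 = 0` makes both soft minima zero.
  rcases s.eq_empty_or_nonempty with rfl | hsne
  · have e : ∀ x : Fin n → Fin p → ℝ,
        normalizedSoftMin β ∅ (fun i => ℓs i ρ) R x = 0 := fun x => by
      simp [normalizedSoftMin, softMin]
    simp only [e, integral_const, probReal_univ, sub_self, abs_zero]
    positivity
  let i₀ : Fin n := ⟨0, hn⟩
  have hF : Measurable fun x => g (normalizedSoftMin β s (fun i => ℓs i ρ) R x) :=
    (hg.continuous.comp (continuous_normalizedSoftMin hn β hsne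
      (fun i => (hℓ.smooth_contDiff i ρ hρ).continuous) R)).measurable
  rw [hX.integral_eq i₀ hF, hW.integral_eq i₀ hF]
  have hM0 : 0 ≤ M₁ := by linarith
  have HX := (hX.mono hMM).isRowLaw hn hM0 i₀
  have HW := (hW.mono hMM).isRowLaw hn hM0 i₀
  obtain ⟨k, c, hcd, hcX⟩ := (hX.blockDependent i₀).exists_cell (hX.measurable i₀)
  obtain ⟨k', c', hcd', hcW⟩ := (hW.blockDependent i₀).exists_cell (hW.measurable i₀)
  have hpX : IsProbabilityMeasure (P.map (X i₀)) :=
    Measure.isProbabilityMeasure_map (hX.measurable i₀).aemeasurable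
  have hpW : IsProbabilityMeasure (P'.map (W i₀)) :=
    Measure.isProbabilityMeasure_map (hW.measurable i₀).aemeasurable
  have hpY := isProbabilityMeasure_glue (lam := P.map (X i₀)) c c'
  have HY := isRowLaw_glue HX HW hcX hcW
  have hp : 0 < p := by
    rcases Nat.eq_zero_or_pos p with rfl | hp
    · simp only [Nat.cast_zero, zero_div] at hpn0
      linarith
    · exact hp
  -- The cell of some coordinate is nonempty, as `p > 0` by the proportional regime.
  have hd1 : 1 ≤ d := by
    refine le_trans ?_ (hcd (c ⟨0, hp⟩))
    exact Finset.card_pos.2 ⟨⟨0, hp⟩, by simp⟩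
  have hquad := dotProduct_mulVec_le_of_eigenvalues_le hS.isHermitian fun j => (hSM j).trans hMM
  have h1 := abs_integral_pi_sub_le_of_common_partition hM1 HX HY hcX (isBlockIndep_glue c c') hcd
    hd1 hn hτ0 hτ1.le hpn hquad hL hsne hs hℓ R hρ hβ hg hgb (m := m) rfl
  have h2 := abs_integral_pi_sub_le_of_common_partition hM1 HY HW (isBlockIndep_glue' c c') hcW hcd'
    hd1 hn hτ0 hτ1.le hpn hquad hL hsne hs hℓ R hρ hβ hg hgb (m := m) rfl
  refine (abs_sub_le _ _ _).trans ((add_le_add h1 h2).trans (le_of_eq ?_))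
  ring
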